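/- Let $m,n\ge 1$ be integers. Number the vertices of a convex $(mn+2)$-gon counter-clockwise by $0,1,\dots,mn+1$. An $(m+2)$-angulation of it is a set of pairwise non-crossing diagonals that cut the polygon into $(m+2)$-sided regions. Let $Q_0$ be the fan with apex $0$, that is, the $(m+2)$-angulation whose diagonals are those joining $0$ to $mk+1$ for $1\le k\le n-1$; the $k$-th of them has label $k$. Let $x<y<\dots<\omega$ be $m$ letters. Label the vertices $2,3,\dots,mn+1$ by repeating the sequence $x,y,\dots,\omega$, and label the vertex $1$ by $\omega$. Consider the polynomial ring $\mathbb{Q}[x_1,\dots,x_n,y_1,\dots,y_n,\dots,\omega_1,\dots,\omega_n]$ in $mn$ variables. For a diagonal $d$ of an $(m+2)$-angulation set $m_d=1$ if $d\in Q_0$. Otherwise $d$ joins vertices $a<b$ with $a\geq 1$; let $u$ and $v$ be the letters of $a$ and $b$, let $i$ and $j$ be the smallest and the largest label of a diagonal of $Q_0$ crossed by $d$, and set $m_d=v_{j+1}-u_i$. For an $(m+2)$-angulation $Q$ put $P_Q=\prod_{d\in Q}m_d$. Take leading monomials for the lexicographic order induced by $x_1<y_1<\dots<\omega_1<x_2<\dots<\omega_2<\dots<x_n<\dots<\omega_n$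 (the largest variable whose exponents differ decides). To a vector $v=(v_1,\dots,v_{mn})\in\mathbb{N}^{mn}$ associate the monomial $$\mathcal{A}_v=(x_1^{v_1}y_1^{v_2}\cdots\omega_1^{v_m})(x_2^{v_{m+1}}\cdots\omega_2^{v_{2m}})\cdots(x_n^{v_{m(n-1)+1}}\cdots\omega_n^{v_{mn}})$$ and the lattice path from $(0,0)$ that has, for each entry $v_\ell$ from left to right, $v_\ell$ right steps $(m,0)$ followed by one up step $(0,1)$. Call $v$ an $m$-Dyck vector if this path always stays weakly above the diagonal $\{x=y\}$ of the plane; equivalently, $m(v_1+\dots+v_\ell)<\ell$ for all $1\le\ell\le mn$. Let $\mathcal{B}_{m,n}$ be the set of all monomials $\mathcal{A}_v$ with $v\in\mathbb{N}^{mn}$ an $m$-Dyck vector. Then all polynomials $P_Q$ are non-zero, and the map sending $Q$ to the leading monomial of $P_Q$ is a bijection from the set of $(m+2)$-angulations of the $(mn+2)$-gon onto $\mathcal{B}_{m,n}$. In particular, the set of leading monomials of the polynomials $P_Q$ coincides with $\mathcal{B}_{m,n}$. -/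

import Mathlib

/-!
Fix `m, n`. The vertices of the convex `(m * n + 2)`-gon are the numbers
`0, 1, …, m * n + 1` in counter-clockwise order, the vertex `0` being the apex.
A segment joining two vertices is written as the pair `(a, b)` with `a < b`.
-/

namespace FanBasis

open MvPolynomial

/-- `(a, b)` is a side of the convex polygon with `N` vertices `0, …, N - 1`. -/
def IsSide (N : ℕ) (d : ℕ × ℕ) : Prop :=
  d.1 < d.2 ∧ d.2 < N ∧ (d.2 = d.1 + 1 ∨ (d.1 = 0 ∧ d.2 + 1 = N))

/-- `(a, b)`, with `a < b`, is a diagonal of the convex polygon with vertices `0, …, N - 1`. -/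
def IsDiagonal (N : ℕ) (d : ℕ × ℕ) : Prop :=
  d.1 < d.2 ∧ d.2 < N ∧ ¬ IsSide N d

/-- Two segments (written with increasing end points) cross in their interiors. -/
def Crosses (d e : ℕ × ℕ) : Prop :=
  (d.1 < e.1 ∧ e.1 < d.2 ∧ d.2 < e.2) ∨ (e.1 < d.1 ∧ d.1 < e.2 ∧ e.2 < d.2)

instance (d e : ℕ × ℕ) : Decidable (Crosses d e) := by
  unfold Crosses; infer_instance

/-- For `a < b` in `S`: the vertices `a` and `b` are neighbours in the cyclic order of `S`, so
that `(a, b)` is a side of the convex polygon spanned by `S`. -/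
def CyclicallyConsecutive (S : Finset ℕ) (a b : ℕ) : Prop :=
  (∀ c ∈ S, ¬ (a < c ∧ c < b)) ∨ (∀ c ∈ S, a ≤ c ∧ c ≤ b)

/-- `S` is the vertex set of one of the regions into which the pairwise non-crossing diagonals
in `Q` cut the polygon: a convex polygon whose sides are sides of the big polygon or diagonals in
`Q`, and whose interior is not cut by a diagonal in `Q`. -/
def IsRegion (N : ℕ) (Q : Finset (ℕ × ℕ)) (S : Finset ℕ) : Prop :=
  3 ≤ S.card ∧ (∀ a ∈ S, a < N) ∧
    ∀ a ∈ S, ∀ b ∈ S, a < b →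
      (CyclicallyConsecutive S a b → IsSide N (a, b) ∨ (a, b) ∈ Q) ∧
      (¬ CyclicallyConsecutive S a b → (a, b) ∉ Q)

/-- `Q` is an `(m + 2)`-angulation of the convex `(m * n + 2)`-gon: a set of pairwise
non-crossing diagonals that cut the polygon into `(m + 2)`-sided regions. -/
def IsAngulation (m n : ℕ) (Q : Finset (ℕ × ℕ)) : Prop :=
  (∀ d ∈ Q, IsDiagonal (m * n + 2) d) ∧
  (∀ d ∈ Q, ∀ e ∈ Q, ¬ Crosses d e) ∧
  ∀ S : Finset ℕ, IsRegion (m * n + 2) Q S → S.card = m + 2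

/-- The diagonal with label `k` of the fan `Q₀` with apex `0`, for `1 ≤ k ≤ n - 1`. -/
def fanDiagonal (m k : ℕ) : ℕ × ℕ := (0, m * k + 1)

/-- The fan `Q₀`: the `(m + 2)`-angulation all of whose diagonals contain the apex `0`. -/
def fan (m n : ℕ) : Finset (ℕ × ℕ) := (Finset.Ico 1 n).image (fanDiagonal m)

/-- The letter (`0` for `x`, `1` for `y`, …, `m - 1` for `ω`) of the vertex `a ≥ 1`. The
vertices `1, 2, 3, …, m * n + 1` are labelled `ω, x, y, …, ω, x, …, ω`. -/
def letter (m a : ℕ) : ℕ := (a + m - 2) % m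

/-- The index set of the variables: `n` places, each with `m` letters. In `Fin n ×ₗ Fin m` the
order is `x₁ < y₁ < ⋯ < ω₁ < x₂ < ⋯ < ωₙ`; it is reversed because `MonomialOrder.lex` makes
`X i` larger than `X j` when `i < j`. -/
abbrev Var (m n : ℕ) : Type := (Fin n ×ₗ Fin m)ᵒᵈ

/-- The polynomial ring `ℚ[x₁, …, xₙ, y₁, …, yₙ, …, ω₁, …, ωₙ]`. -/
abbrev PolyRing (m n : ℕ) : Type := MvPolynomial (Var m n) ℚ

/-- The index of the variable with letter `a` at the place `k` (both counted from `0`). -/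
def varIndex {m n : ℕ} (k : Fin n) (a : Fin m) : Var m n := OrderDual.toDual (toLex (k, a))

/-- The variable `t_k`, where `t` is the letter number `a < m` (counted from `0`)
and `1 ≤ k ≤ n`; outside these ranges the value `0` is never used. -/
noncomputable def letterVar (m n a k : ℕ) : PolyRing m n :=
  if h : (1 ≤ k ∧ k ≤ n) ∧ a < m then X (varIndex ⟨k - 1, by omega⟩ ⟨a, h.2⟩) else 0

/-- The labels of the diagonals of `Q₀` that are crossed by `d`. -/
def crossedLabels (m n : ℕ) (d : ℕ × ℕ) : Finset ℕ :=
  (Finset.Ico 1 n).filter (fun k => Crosses d (fanDiagonal m k))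

/-- The polynomial `m_d`: it is `1` if `d` is in `Q₀`; otherwise it is `v_{j+1} - u_i`, where
`u` and `v` are the letters of the starting point and the end point of `d`, and `i`, `j` are the
least and the greatest label of the diagonals of `Q₀` crossed by `d`. -/
noncomputable def diagonalPoly (m n : ℕ) (d : ℕ × ℕ) : PolyRing m n :=
  if d ∈ fan m n then 1
  else letterVar m n (letter m d.2) (sSup (crossedLabels m n d : Set ℕ) + 1)
    - letterVar m n (letter m d.1) (sInf (crossedLabels m n d : Set ℕ))

/-- The polynomial `P_Q`. -/
noncomputable def angulationPoly (m n : ℕ) (Q : Finset (ℕ × ℕ)) : PolyRing m n :=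
  ∏ d ∈ Q, diagonalPoly m n d

/-- The leading monomial of a (non-zero) polynomial, for the lexicographic order induced by
`x₁ < y₁ < ⋯ < ω₁ < x₂ < ⋯ < ωₙ`. -/
noncomputable def leadingMonomial {m n : ℕ} (p : PolyRing m n) : PolyRing m n :=
  monomial ((MonomialOrder.lex (σ := Var m n)).degree p) 1

/-- The steps of the lattice path of an `m`-vector `v` of size `n`: for each entry `c` of `v`,
from left to right, `c` right steps `(m, 0)` followed by one up step `(0, 1)`. -/
def latticePath {m n : ℕ} (v : Fin (m * n) → ℕ) : List (ℕ × ℕ) :=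
  (List.ofFn v).flatMap (fun c => List.replicate c (m, 0) ++ [(0, 1)])

/-- `v` is an `m`-Dyck vector: its path, started at `(0, 0)`, always remains (weakly) above the
diagonal. The points of the path are the sums of the initial segments of its list of steps. -/
def IsDyckVector {m n : ℕ} (v : Fin (m * n) → ℕ) : Prop :=
  ∀ l : List (ℕ × ℕ), l <+: latticePath v → l.sum.1 ≤ l.sum.2

/-- The position, in an `m`-vector of size `n`, of the letter `a` of the block `k` (all counted
from `0`). -/
def blockIndex {m n : ℕ} (k : Fin n) (a : Fin m) : Fin (m * n) :=
  ⟨m * k + a, by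
    have h : m * (k + 1) ≤ m * n := Nat.mul_le_mul_left m k.isLt
    have h2 : m * ((k : ℕ) + 1) = m * k + m := Nat.mul_succ m k
    have h3 := a.isLt
    omega⟩

/-- The monomial `A_v = (x₁^{v₁} y₁^{v₂} ⋯ ω₁^{v_m}) ⋯ (xₙ^{v_{m(n-1)+1}} ⋯ ωₙ^{v_{mn}})`. -/
noncomputable def vectorMonomial {m n : ℕ} (v : Fin (m * n) → ℕ) : PolyRing m n :=
  ∏ k : Fin n, ∏ a : Fin m, X (varIndex k a) ^ v (blockIndex k a)

/-- The set `B_{m,n}` of the monomials `A_v`, for `v` an `m`-Dyck vector of size `n`. -/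
def monomialBasis (m n : ℕ) : Set (PolyRing m n) :=
  {p | ∃ v : Fin (m * n) → ℕ, IsDyckVector v ∧ vectorMonomial v = p}

end FanBasis

/-!
Renumber the apex `0` as `N = m * n + 2`. A set `Q` of non-crossing diagonals then becomes a set of
non-crossing arcs on the points `1, …, N` of a line, to which the outer arc `(1, N)` is added
(`arcs`). The regions of the polygon correspond to the arcs: the region below an arc consists of its
end points and of the points for which it is the innermost arc above them
(`IsArcSystem.isLineRegion`, `IsArcSystem.exists_of_isLineRegion`). Hence `Q` is an
`(m + 2)`-angulation if and only if every arc is the innermost one above exactly `m` points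
(`isAngulation_iff`).

Every point below an arc has exactly one innermost arc above it. So, in a balanced arc system,
`b - a - 1` is `m` times the number of arcs inside `[a, b]` if `(a, b)` is an arc, and at least `m`
times the number of arcs of any set of arcs inside `[a, b]` otherwise. Therefore a diagonal not
containing the apex is of the form `(a, a + 1 + m * r)`, and `m_d` is the difference of a variable
whose position depends only on the larger end point of `d` and of a variable in an earlier block;
a diagonal containing the apex lies in the fan. The exponents of the leading monomial of `P_Q` are
thus the numbers of arcs ending at `2, …, N - 1` (`degree_angulationPoly`).

It remains to recover a balanced arc system from the numbers `v b` of its arcs ending at `b`, and to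
see which `v` occur. Read from left to right, each arc ending at `b` hides the last `m` points still
visible from `b`. So the height `h c = c - m * (v 1 + ⋯ + v c)` is the number of points visible just
after `c`, and the arcs can be read off from `h` (`heightArcs`). The count above shows that every
arc has the required shape, and equality follows since all balanced arc systems have the same size
(`IsBalanced.eq_heightArcs`). Conversely, the arcs read off from a height function with `h c ≥ 2`
for `c ≥ 2`, which is the Dyck condition, form a balanced arc system with the right numbers of
closing arcs (`IsDyckHeight.isBalanced`, `IsDyckHeight.closing_heightArcs`). The entry at `N` is
determined by the others, because `h N = 2`.
-/

namespace FanBasis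

open MvPolynomial

/-! ### Arc systems and double counting -/

/-- The vertices `c` strictly below the arc `d` for which `d` is the innermost arc of `R`
above `c`. -/
def interior (R : Finset (ℕ × ℕ)) (d : ℕ × ℕ) : Finset ℕ :=
  (Finset.Ioo d.1 d.2).filter (fun c => ∀ e ∈ R, e.1 < c → c < e.2 → e.1 ≤ d.1 ∧ d.2 ≤ e.2)

/-- A set of pairwise non-crossing arcs on the points `1, …, N` of a line, none of which joins
neighbours, and which contains the outer arc `(1, N)`. -/
structure IsArcSystem (N : ℕ) (R : Finset (ℕ × ℕ)) : Prop where
  root_mem : (1, N) ∈ R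
  one_le : ∀ d ∈ R, 1 ≤ d.1
  lt : ∀ d ∈ R, d.1 + 1 < d.2
  le : ∀ d ∈ R, d.2 ≤ N
  noncrossing : ∀ d ∈ R, ∀ e ∈ R, ¬ Crosses d e

/-- An arc system each of whose arcs is the innermost one above exactly `m` points. -/
structure IsBalanced (m N : ℕ) (R : Finset (ℕ × ℕ)) : Prop extends IsArcSystem N R where
  card_interior : ∀ d ∈ R, (interior R d).card = m

theorem mem_interior {R : Finset (ℕ × ℕ)} {d : ℕ × ℕ} {c : ℕ} :
    c ∈ interior R d ↔ (d.1 < c ∧ c < d.2) ∧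
      ∀ e ∈ R, e.1 < c → c < e.2 → e.1 ≤ d.1 ∧ d.2 ≤ e.2 := by
  simp [interior]

theorem pairwiseDisjoint_interior (R : Finset (ℕ × ℕ)) :
    (R : Set (ℕ × ℕ)).PairwiseDisjoint (interior R) := by
  intro d hd e he hne
  refine Finset.disjoint_left.2 fun c hc hc' => hne ?_
  rw [mem_interior] at hc hc'
  have h1 := hc.2 e he hc'.1.1 hc'.1.2
  have h2 := hc'.2 d hd hc.1.1 hc.1.2
  exact Prod.ext (by omega) (by omega)

/-- Every point below an arc `d` has an innermost arc above it, which lies inside `d`. -/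
theorem IsArcSystem.exists_mem_interior {N : ℕ} {R : Finset (ℕ × ℕ)} (hR : IsArcSystem N R)
    {d : ℕ × ℕ} (hd : d ∈ R) {c : ℕ} (h1 : d.1 < c) (h2 : c < d.2) :
    ∃ e ∈ R, d.1 ≤ e.1 ∧ e.2 ≤ d.2 ∧ c ∈ interior R e := by
  obtain ⟨e, he, hmin⟩ := Finset.exists_min_image (R.filter fun e => e.1 < c ∧ c < e.2)
    (fun e => e.2 - e.1) ⟨d, by simp [hd, h1, h2]⟩
  simp only [Finset.mem_filter] at he hmin
  have key : ∀ f ∈ R, f.1 < c → c < f.2 → f.1 ≤ e.1 ∧ e.2 ≤ f.2 := by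
    intro f hf hf1 hf2
    have h3 := hmin f ⟨hf, hf1, hf2⟩
    have h4 := hR.noncrossing f hf e he.1
    unfold Crosses at h4
    omega
  have := key d hd h1 h2
  exact ⟨e, he.1, this.1, this.2, mem_interior.2 ⟨he.2, key⟩⟩

/-- Disjoint sets of `m` points lie below the arcs of `T`, all between `a` and `b`. -/
theorem IsBalanced.mul_card_le {m N : ℕ} {R : Finset (ℕ × ℕ)} (hR : IsBalanced m N R)
    {T : Finset (ℕ × ℕ)} (hT : T ⊆ R) {a b : ℕ} (hab : ∀ d ∈ T, a ≤ d.1 ∧ d.2 ≤ b) :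
    m * T.card ≤ b - a - 1 := by
  have h1 : (T.biUnion (interior R)).card = m * T.card := by
    rw [Finset.card_biUnion ((pairwiseDisjoint_interior R).subset (by exact_mod_cast hT)),
      Finset.sum_congr rfl fun d hd => hR.card_interior d (hT hd)]
    simp [mul_comm]
  have h2 : T.biUnion (interior R) ⊆ Finset.Ioo a b := by
    intro c hc
    obtain ⟨d, hd, hc⟩ := Finset.mem_biUnion.1 hc
    have := hab d hd
    have := (mem_interior.1 hc).1
    exact Finset.mem_Ioo.2 (by omega)
  have h3 := Finset.card_le_card h2
  rw [Nat.card_Ioo] at h3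
  omega

/-- The points below `d` are partitioned by the arcs inside `d`, into parts with `m` elements. -/
theorem IsBalanced.mul_card_inside {m N : ℕ} {R : Finset (ℕ × ℕ)} (hR : IsBalanced m N R)
    {d : ℕ × ℕ} (hd : d ∈ R) :
    m * (R.filter fun e => d.1 ≤ e.1 ∧ e.2 ≤ d.2).card = d.2 - d.1 - 1 := by
  refine le_antisymm (hR.mul_card_le (Finset.filter_subset _ _) fun e he =>
    (Finset.mem_filter.1 he).2) ?_
  have h2 : Finset.Ioo d.1 d.2 ⊆
      (R.filter fun e => d.1 ≤ e.1 ∧ e.2 ≤ d.2).biUnion (interior R) := by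
    intro c hc
    rw [Finset.mem_Ioo] at hc
    obtain ⟨e, he, h1, h2, h3⟩ := hR.exists_mem_interior hd hc.1 hc.2
    exact Finset.mem_biUnion.2 ⟨e, by simp [he, h1, h2], h3⟩
  have h3 := Finset.card_le_card h2
  rw [Nat.card_Ioo, Finset.card_biUnion ((pairwiseDisjoint_interior R).subset (by
    exact_mod_cast Finset.filter_subset _ _)),
    Finset.sum_congr rfl fun d hd => hR.card_interior d (Finset.mem_filter.1 hd).1] at h3
  simpa [mul_comm] using h3

/-! ### The height function -/

/-- The number of arcs of `R` ending at `b`. -/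
def closing (R : Finset (ℕ × ℕ)) (b : ℕ) : ℕ := (R.filter fun d => d.2 = b).card

/-- If `v b` is the number of arcs ending at `b`, each of which hides `m` points, this is the
number of points `≤ c` that are not below an arc ending in `1, …, c`. -/
def height (m : ℕ) (v : ℕ → ℕ) (c : ℕ) : ℤ := c - m * ∑ i ∈ Finset.range (c + 1), (v i : ℤ)

/-- The height function of an `m`-Dyck vector `v`, the indices of which are shifted by two, and
to which the entry at `N` is added for which the total is right. -/
structure IsDyckHeight (m N : ℕ) (v : ℕ → ℕ) : Prop where
  two_lt : 2 < N
  zero : v 0 = 0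
  one : v 1 = 0
  two_le : ∀ c, 2 ≤ c → c ≤ N → 2 ≤ height m v c
  last : height m v N = 2

/-- The arcs read off from a height function `h`. The arcs ending at `b` start at the points `a`
still visible from `b` (those with `h a < h c` for `a < c < b`) for which the number
`h (b - 1) - h a` of visible points between them and `b` is `m, 2 * m, …`, down to the height
`h b - 1`. -/
def heightArcs (m N : ℕ) (h : ℕ → ℤ) : Finset (ℕ × ℕ) :=
  (Finset.Icc 1 N ×ˢ Finset.Icc 1 N).filter fun d => d.1 < d.2 ∧
    (∀ c ∈ Finset.Ioo d.1 d.2, h d.1 < h c) ∧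
    h d.2 ≤ h d.1 + 1 ∧ h d.1 < h (d.2 - 1) ∧ (m : ℤ) ∣ h (d.2 - 1) - h d.1

theorem mem_heightArcs {m N : ℕ} {h : ℕ → ℤ} {a b : ℕ} :
    (a, b) ∈ heightArcs m N h ↔ 1 ≤ a ∧ a < b ∧ b ≤ N ∧ (∀ c, a < c → c < b → h a < h c) ∧
      h b ≤ h a + 1 ∧ h a < h (b - 1) ∧ (m : ℤ) ∣ h (b - 1) - h a := by
  simp only [heightArcs, Finset.mem_filter, Finset.mem_product, Finset.mem_Icc, Finset.mem_Ioo,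
    and_imp]
  constructor
  · rintro ⟨h1, h2, h3, h4⟩
    exact ⟨by omega, h2, by omega, h3, h4⟩
  · rintro ⟨h1, h2, h3, h4⟩
    exact ⟨by omega, h2, h4⟩

theorem height_succ (m : ℕ) (v : ℕ → ℕ) (c : ℕ) :
    height m v (c + 1) = height m v c + 1 - m * v (c + 1) := by
  simp only [height, Finset.sum_range_succ _ (c + 1)]
  push_cast
  ring

theorem height_pred {m : ℕ} {v : ℕ → ℕ} {b : ℕ} (hb : 1 ≤ b) :
    height m v b = height m v (b - 1) + 1 - m * v b := by
  obtain ⟨c, rfl⟩ : ∃ c, b = c + 1 := ⟨b - 1, by omega⟩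
  simpa using height_succ m v c

theorem height_succ_le (m : ℕ) (v : ℕ → ℕ) (c : ℕ) :
    height m v (c + 1) ≤ height m v c + 1 := by
  rw [height_succ]
  have : (0 : ℤ) ≤ m * v (c + 1) := by positivity
  linarith

theorem IsDyckHeight.height_one {m N : ℕ} {v : ℕ → ℕ} (hv : IsDyckHeight m N v) :
    height m v 1 = 1 := by
  simp [height, Finset.sum_range_succ, hv.zero, hv.one]

/-- A function that increases by at most one at each step takes every intermediate value, at a
point which is visible from `b`. -/
theorem exists_visible {h : ℕ → ℤ} (hs : ∀ c, h (c + 1) ≤ h c + 1) {t : ℤ} (h1 : h 1 ≤ t)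
    {b : ℕ} (hb : 1 ≤ b) (ht : t ≤ h b) :
    ∃ a, 1 ≤ a ∧ a ≤ b ∧ h a = t ∧ ∀ c, a < c → c ≤ b → t < h c := by
  induction b, hb using Nat.le_induction with
  | base => exact ⟨1, le_rfl, le_rfl, by omega, fun c _ _ => by omega⟩
  | succ b hb ih =>
    rcases eq_or_lt_of_le ht with rfl | ht
    · exact ⟨b + 1, by omega, le_rfl, rfl, fun c _ _ => by omega⟩
    · obtain ⟨a, ha1, ha2, ha3, ha4⟩ := ih (by have := hs b; omega)
      refine ⟨a, ha1, by omega, ha3, fun c hc hc' => ?_⟩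
      rcases eq_or_lt_of_le hc' with rfl | hc'
      · exact ht
      · exact ha4 c hc (by omega)

/-- The points visible from `b` are in bijection with their heights. -/
theorem card_visible {h : ℕ → ℤ} (hs : ∀ c, h (c + 1) ≤ h c + 1) {b : ℕ} (hb : 1 < b)
    (T : Finset ℤ) (hT : ∀ t ∈ T, h 1 ≤ t ∧ t ≤ h (b - 1)) (A : Finset ℕ)
    (hA : ∀ a, a ∈ A ↔ 1 ≤ a ∧ a < b ∧ (∀ c, a < c → c < b → h a < h c) ∧ h a ∈ T) :
    A.card = T.card := by
  refine Finset.card_bij (fun a _ => h a) (fun a ha => ((hA a).1 ha).2.2.2) ?_ ?_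
  · intro a ha a' ha' heq
    obtain ⟨-, h1, h2, -⟩ := (hA a).1 ha
    obtain ⟨-, h3, h4, -⟩ := (hA a').1 ha'
    rcases lt_trichotomy a a' with hlt | rfl | hlt
    · have := h2 a' hlt h3; omega
    · rfl
    · have := h4 a hlt h1; omega
  · intro t ht
    obtain ⟨a, h1, h2, h3, h4⟩ := exists_visible hs (hT t ht).1 (b := b - 1) (by omega)
      (hT t ht).2
    refine ⟨a, (hA a).2 ⟨h1, by omega, fun c hc hc' => ?_, h3 ▸ ht⟩, h3⟩
    rw [h3]
    exact h4 c hc (by omega)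

/-! ### From Dyck vectors to balanced arc systems -/

theorem IsDyckHeight.isArcSystem {m N : ℕ} {v : ℕ → ℕ} (hv : IsDyckHeight m N v) :
    IsArcSystem N (heightArcs m N (height m v)) where
  root_mem := by
    have h2 := hv.two_lt
    have h1 := hv.height_one
    refine mem_heightArcs.2 ⟨le_rfl, by omega, le_rfl, fun c hc hc' => ?_, ?_, ?_, ?_⟩
    · have := hv.two_le c (by omega) (by omega); omega
    · have := hv.last; omega
    · have := hv.two_le (N - 1) (by omega) (by omega); omega
    · have := height_pred (m := m) (v := v) (b := N) (by omega)
      exact ⟨v N, by rw [hv.last] at this; omega⟩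
  one_le := fun d hd => (mem_heightArcs.1 hd).1
  lt := fun d hd => by
    obtain ⟨-, h1, -, -, -, h2, -⟩ := mem_heightArcs.1 hd
    by_contra hlt
    rw [show d.2 - 1 = d.1 by omega] at h2
    exact lt_irrefl _ h2
  le := fun d hd => (mem_heightArcs.1 hd).2.2.1
  noncrossing := by
    have key : ∀ d ∈ heightArcs m N (height m v), ∀ e ∈ heightArcs m N (height m v),
        d.1 < e.1 → e.1 < d.2 → d.2 < e.2 → False := by
      intro d hd e he h1 h2 h3
      have h4 := (mem_heightArcs.1 hd).2.2.2.1 e.1 h1 h2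
      have h5 := (mem_heightArcs.1 he).2.2.2.1 d.2 h2 h3
      have h6 := (mem_heightArcs.1 hd).2.2.2.2.1
      omega
    rintro d hd e he (⟨h1, h2, h3⟩ | ⟨h1, h2, h3⟩)
    · exact key d hd e he h1 h2 h3
    · exact key e he d hd h1 h2 h3

theorem IsDyckHeight.closing_heightArcs {m N : ℕ} (hm : 1 ≤ m) {v : ℕ → ℕ}
    (hv : IsDyckHeight m N v) {b : ℕ} (hb : b ≤ N) :
    closing (heightArcs m N (height m v)) b = v b := by
  set h := height m v with hh
  have harc := hv.isArcSystem
  rw [← hh] at harc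
  by_cases hb1 : b ≤ 1
  · have h0 : v b = 0 := by
      rcases Nat.le_one_iff_eq_zero_or_eq_one.1 hb1 with rfl | rfl
      · exact hv.zero
      · exact hv.one
    rw [h0, closing, Finset.card_eq_zero, Finset.filter_eq_empty_iff]
    intro d hd
    have := harc.lt d hd
    have := harc.one_le d hd
    omega
  have hpred : h b = h (b - 1) + 1 - m * v b := height_pred (by omega)
  have h2b := hv.two_le b (by omega) hb
  rw [← hh] at h2b
  have h1 : h 1 = 1 := hv.height_one
  have hm' : (0 : ℤ) < m := by exact_mod_cast hm
  -- the heights of the starting points of the arcs ending at `b`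
  let T : Finset ℤ := (Finset.Icc 1 (v b)).image fun k : ℕ => h (b - 1) - m * k
  have hTcard : T.card = v b := by
    rw [Finset.card_image_of_injective, Nat.card_Icc]
    · omega
    · intro k k' hk
      have : (m : ℤ) * k = m * k' := by simpa using hk
      exact_mod_cast mul_left_cancel₀ hm'.ne' this
  have hTmem : ∀ t, t ∈ T ↔ h b ≤ t + 1 ∧ t < h (b - 1) ∧ (m : ℤ) ∣ h (b - 1) - t := by
    intro t
    simp only [T, Finset.mem_image, Finset.mem_Icc]
    constructor
    · rintro ⟨k, ⟨hk1, hk2⟩, rfl⟩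
      have h3 : (m : ℤ) * k ≤ m * v b := by gcongr
      have h4 : (0 : ℤ) < m * k := by positivity
      exact ⟨by omega, by omega, ⟨k, by ring⟩⟩
    · rintro ⟨h3, h4, k, hk⟩
      have h5 : 0 < k := pos_of_mul_pos_right (by omega : (0 : ℤ) < m * k) hm'.le
      have h6 : k ≤ v b := le_of_mul_le_mul_left (by omega : (m : ℤ) * k ≤ m * v b) hm'
      refine ⟨k.toNat, ⟨by omega, by omega⟩, ?_⟩
      rw [Int.toNat_of_nonneg h5.le]
      omega
  have hinj : Set.InjOn (Prod.fst : ℕ × ℕ → ℕ)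
      ((heightArcs m N h).filter fun d => d.2 = b : Finset (ℕ × ℕ)) := by
    intro d hd e he hde
    simp only [Finset.coe_filter, Set.mem_ofPred_eq] at hd he
    exact Prod.ext hde (by rw [hd.2, he.2])
  rw [closing, ← Finset.card_image_of_injOn hinj, ← hTcard]
  refine card_visible (h := h) (height_succ_le m v) (b := b) (by omega) T ?_ _ ?_
  · intro t ht
    have := (hTmem t).1 ht
    omega
  · intro a
    simp only [Finset.mem_image, Finset.mem_filter, Prod.exists, exists_and_right,
      exists_eq_right, hTmem]
    constructor
    · intro h3
      obtain ⟨h4, h5, h6, h7, h8⟩ := mem_heightArcs.1 h3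
      exact ⟨h4, h5, h7, h8⟩
    · rintro ⟨h4, h5, h7, h8⟩
      exact mem_heightArcs.2 ⟨h4, h5, hb, h7, h8⟩

/-- The points `c` whose innermost arc is `(a, b)` are those visible from `b` with
`h a < h c ≤ h a + m`; their heights take each of these `m` values once. -/
theorem IsDyckHeight.isBalanced {m N : ℕ} (hm : 1 ≤ m) {v : ℕ → ℕ} (hv : IsDyckHeight m N v) :
    IsBalanced m N (heightArcs m N (height m v)) := by
  refine ⟨hv.isArcSystem, ?_⟩
  rintro ⟨a, b⟩ hd
  have harc := hv.isArcSystem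
  set h := height m v with hh
  have h1 : h 1 = 1 := hv.height_one
  have hm' : (0 : ℤ) < m := by exact_mod_cast hm
  obtain ⟨ha, hab, hbN, hvis, hlow, hlt, hdvd⟩ := mem_heightArcs.1 hd
  have hle : h a + m ≤ h (b - 1) := by
    have := Int.le_of_dvd (by omega) hdvd
    omega
  have hs : ∀ c, h (c + 1) ≤ h c + 1 := height_succ_le m v
  have ha1 : h 1 ≤ h a := by
    rcases eq_or_lt_of_le ha with rfl | ha
    · rfl
    · have := hv.two_le a ha (by omega)
      rw [← hh] at this
      omega
  rw [card_visible hs (b := b) (by omega) (Finset.Ioc (h a) (h a + m))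
    (fun t ht => by rw [Finset.mem_Ioc] at ht; omega)]
  · simp
  intro c
  rw [mem_interior, Finset.mem_Ioc]
  constructor
  · rintro ⟨⟨hac, hcb⟩, hin⟩
    simp only at hac hcb
    have hhac := hvis c hac hcb
    have hvisc : ∀ e, c < e → e < b → h c < h e := by
      -- otherwise the longest arc ending at the first `e` with `h e ≤ h c` separates `c` from `b`
      by_contra! hcon
      obtain ⟨hce, heb, hec⟩ := Nat.find_spec hcon
      have hmin := fun k (hk : k < Nat.find hcon) => Nat.find_min hcon hk
      set e := Nat.find hcon
      have hbelow : ∀ k, c ≤ k → k < e → h c ≤ h k := by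
        intro k hk hke
        rcases eq_or_lt_of_le hk with rfl | hk
        · rfl
        · have := hmin k hke
          push Not at this
          exact (this hk (by omega)).le
      have he1 := hbelow (e - 1) (by omega) (by omega)
      have hae := hvis e (by omega) heb
      have hpred : h e = h (e - 1) + 1 - m * v e := height_pred (by omega)
      obtain ⟨d, hd1, hd2, hd3, hd4⟩ := exists_visible hs (t := h e - 1) (by omega)
        (b := e - 1) (by omega) (by omega)
      have hda : a ≤ d := by
        by_contra! hda
        have := hd4 a hda (by omega)
        omega
      have hdc : d < c := by
        by_contra! hdc
        have := hbelow d hdc (by omega)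
        omega
      have hmem : (d, e) ∈ heightArcs m N h :=
        mem_heightArcs.2 ⟨hd1, by omega, by omega, fun k hk hk' => by
          have := hd4 k hk (by omega)
          omega, by omega, by omega, ⟨v e, by omega⟩⟩
      have := hin _ hmem hdc hce
      simp only at this
      omega
    refine ⟨by omega, hcb, hvisc, hhac, ?_⟩
    -- otherwise the next shorter arc ending at `b` lies above `c`
    by_contra! hcon
    have hcb1 : h c ≤ h (b - 1) := by
      rcases eq_or_lt_of_le (show c ≤ b - 1 by omega) with heq | hlt'
      · rw [← heq]
      · exact (hvisc (b - 1) hlt' (by omega)).le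
    obtain ⟨d, hd1, hd2, hd3, hd4⟩ := exists_visible hs (t := h a + m) (by omega)
        (b := b - 1) (by omega) hle
    have hdc : d < c := by
      by_contra! hdc
      rcases eq_or_lt_of_le hdc with rfl | hdc
      · omega
      · have := hvisc d hdc (by omega)
        omega
    have had : a < d := by
      by_contra! had
      rcases eq_or_lt_of_le had with rfl | had
      · omega
      · have := hd4 a had (by omega)
        omega
    have hmem : (d, b) ∈ heightArcs m N h :=
      mem_heightArcs.2 ⟨hd1, by omega, by omega, fun k hk hk' => by
        have := hd4 k hk (by omega)
        omega, by omega, by omega, by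
          rw [hd3, show h (b - 1) - (h a + m) = (h (b - 1) - h a) - m by ring]
          exact dvd_sub_self_right.2 hdvd⟩
    have := hin _ hmem hdc hcb
    simp only at this
    omega
  · rintro ⟨hc1, hcb, hvisc, hhac, hhca⟩
    have hac : a < c := by
      by_contra! hac
      rcases eq_or_lt_of_le hac with rfl | hac
      · omega
      · have := hvisc a hac hab
        omega
    refine ⟨⟨hac, hcb⟩, ?_⟩
    rintro ⟨d, e⟩ he hdc hce
    simp only at hdc hce ⊢
    obtain ⟨hd1, hde, heN, hvisd, hlowd, hltd, hdvdd⟩ := mem_heightArcs.1 he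
    have hdc' := hvisd c hdc hce
    have hbe : b ≤ e := by
      by_contra! heb
      have := hvisc e hce heb
      omega
    refine ⟨?_, hbe⟩
    by_contra! had
    rcases eq_or_lt_of_le hbe with rfl | hbe
    · have h3 := hvis d had (by omega)
      have h4 : (m : ℤ) ∣ h d - h a := by
        have := dvd_sub hdvd hdvdd
        rwa [show h (b - 1) - h a - (h (b - 1) - h d) = h d - h a by ring] at this
      have := Int.le_of_dvd (by omega) h4
      omega
    · exact harc.noncrossing _ hd _ he (Or.inl ⟨had, by simp only; omega, hbe⟩)

/-! ### From balanced arc systems to Dyck vectors -/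

theorem sum_closing (R : Finset (ℕ × ℕ)) (s : Finset ℕ) :
    ∑ b ∈ s, closing R b = (R.filter fun d => d.2 ∈ s).card := by
  rw [Finset.card_eq_sum_card_fiberwise (f := Prod.snd) (t := s)
    (fun d hd => by simpa using (Finset.mem_filter.1 hd).2)]
  refine Finset.sum_congr rfl fun b hb => ?_
  rw [closing, Finset.filter_filter]
  congr 1
  ext d
  simp only [Finset.mem_filter]
  constructor
  · rintro ⟨h1, rfl⟩
    exact ⟨h1, hb, rfl⟩
  · rintro ⟨h1, -, h2⟩
    exact ⟨h1, h2⟩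

theorem height_sub_height (m : ℕ) (R : Finset (ℕ × ℕ)) {a c : ℕ} (hac : a ≤ c) :
    height m (closing R) c - height m (closing R) a =
      (c - a : ℤ) - m * (R.filter fun d => a < d.2 ∧ d.2 ≤ c).card := by
  have h1 : ((R.filter fun d => a < d.2 ∧ d.2 ≤ c).card : ℤ) =
      ∑ i ∈ Finset.range (c + 1), (closing R i : ℤ) -
        ∑ i ∈ Finset.range (a + 1), (closing R i : ℤ) := by
    rw [← Nat.cast_sum, ← Nat.cast_sum, ← Finset.sum_range_add_sum_Ico _
      (show a + 1 ≤ c + 1 by omega), sum_closing R (Finset.Ico _ _)]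
    push_cast
    rw [add_sub_cancel_left]
    congr 3
    ext d
    simp only [Finset.mem_Ico]
    omega
  rw [h1, height, height]
  ring

theorem IsBalanced.closing_le_one {m N : ℕ} {R : Finset (ℕ × ℕ)} (hR : IsBalanced m N R) {b : ℕ}
    (hb : b ≤ 1) : closing R b = 0 := by
  rw [closing, Finset.card_eq_zero, Finset.filter_eq_empty_iff]
  intro d hd
  have := hR.lt d hd
  have := hR.one_le d hd
  omega

/-- For an arc `(a, b)`, the increments of the height on `[a, b]` are given by the numbers of arcs
ending there, all of which lie inside `[a, b]`, so they are controlled by double counting. -/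
theorem IsBalanced.subset_heightArcs {m N : ℕ} (hm : 1 ≤ m) {R : Finset (ℕ × ℕ)}
    (hR : IsBalanced m N R) : R ⊆ heightArcs m N (height m (closing R)) := by
  rintro ⟨a, b⟩ hd
  have h1 := hR.one_le _ hd
  have h2 := hR.lt _ hd
  have h3 := hR.le _ hd
  simp only at h1 h2 h3
  have hleft : ∀ e ∈ R, a < e.2 → e.2 < b → a ≤ e.1 := by
    intro e he h4 h5
    have := hR.noncrossing e he _ hd
    unfold Crosses at this
    simp only at this
    omega
  have hin := hR.mul_card_inside hd
  simp only at hin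
  have hpred : ∀ c, a < c → c < b →
      (m : ℤ) * (R.filter fun d => a < d.2 ∧ d.2 ≤ c).card ≤ c - a - 1 := by
    intro c hc hc'
    have := hR.mul_card_le (T := R.filter fun d => a < d.2 ∧ d.2 ≤ c)
      (Finset.filter_subset _ _) (a := a) (b := c) (fun e he => by
        rw [Finset.mem_filter] at he
        exact ⟨hleft e he.1 he.2.1 (by omega), he.2.2⟩)
    zify at this
    rw [Nat.cast_sub (by omega), Nat.cast_sub (by omega)] at this
    exact_mod_cast this
  have hb1 := height_sub_height m R (show a ≤ b - 1 by omega)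
  have hb2 := height_sub_height m R (show a ≤ b by omega)
  have hinZ : (m : ℤ) * (R.filter fun e => a ≤ e.1 ∧ e.2 ≤ b).card = b - a - 1 := by
    zify at hin
    rw [Nat.cast_sub (by omega), Nat.cast_sub (by omega)] at hin
    exact_mod_cast hin
  have hmem : (a, b) ∈ R.filter fun e => a ≤ e.1 ∧ e.2 ≤ b := by simp [hd]
  have hss : (R.filter fun d => a < d.2 ∧ d.2 ≤ b - 1) ⊆
      (R.filter fun e => a ≤ e.1 ∧ e.2 ≤ b).erase (a, b) := by
    intro e he
    rw [Finset.mem_filter] at he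
    refine Finset.mem_erase.2 ⟨?_, Finset.mem_filter.2 ⟨he.1, hleft e he.1 he.2.1 ?_, ?_⟩⟩
    · rintro rfl
      have := he.2.2
      simp only at this
      omega
    · omega
    · omega
  have hss2 : (R.filter fun e => a ≤ e.1 ∧ e.2 ≤ b) ⊆ R.filter fun d => a < d.2 ∧ d.2 ≤ b := by
    intro e he
    rw [Finset.mem_filter] at he ⊢
    have := hR.lt e he.1
    exact ⟨he.1, by omega, by omega⟩
  have hc1 := Finset.card_le_card hss
  rw [Finset.card_erase_of_mem hmem] at hc1
  have hpos := Finset.card_pos.2 ⟨_, hmem⟩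
  have hc2 := Finset.card_le_card hss2
  have hc1' : (m : ℤ) * (R.filter fun d => a < d.2 ∧ d.2 ≤ b - 1).card <
      m * (R.filter fun e => a ≤ e.1 ∧ e.2 ≤ b).card := by
    have : (R.filter fun d => a < d.2 ∧ d.2 ≤ b - 1).card <
      (R.filter fun e => a ≤ e.1 ∧ e.2 ≤ b).card := by omega
    gcongr
  have hc2' : (m : ℤ) * (R.filter fun e => a ≤ e.1 ∧ e.2 ≤ b).card ≤
      m * (R.filter fun d => a < d.2 ∧ d.2 ≤ b).card := by
    gcongr
  have hcast : ((b - 1 : ℕ) : ℤ) = b - 1 := by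
    rw [Nat.cast_sub (by omega)]; rfl
  rw [hcast] at hb1
  refine mem_heightArcs.2 ⟨h1, by omega, h3, fun c hc hc' => ?_, by omega, by omega, ?_⟩
  · have h4 := height_sub_height m R hc.le
    have h5 := hpred c hc hc'
    omega
  · rw [hb1, show ((b : ℤ) - 1 - a) = b - a - 1 by ring, ← hinZ, ← mul_sub]
    exact dvd_mul_right _ _

theorem IsBalanced.mul_card {m N : ℕ} {R : Finset (ℕ × ℕ)} (hR : IsBalanced m N R) :
    m * R.card = N - 2 := by
  have := hR.mul_card_inside hR.root_mem
  rwa [Finset.filter_true_of_mem fun e he => ⟨hR.one_le e he, hR.le e he⟩, Nat.sub_sub] at this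

theorem IsBalanced.isDyckHeight {m N : ℕ} (hm : 1 ≤ m) {R : Finset (ℕ × ℕ)}
    (hR : IsBalanced m N R) : IsDyckHeight m N (closing R) := by
  have h2N : 2 < N := hR.lt _ hR.root_mem
  have hone : height m (closing R) 1 = 1 := by
    simp [height, Finset.sum_range_succ, hR.closing_le_one]
  have hlast : height m (closing R) N = 2 := by
    have h1 := height_sub_height m R (show 1 ≤ N by omega)
    rw [Finset.filter_true_of_mem fun e he =>
      ⟨by have := hR.lt e he; omega, hR.le e he⟩, hone] at h1
    have h2 : (m : ℤ) * R.card = N - 2 := by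
      have := hR.mul_card
      zify at this
      rw [Nat.cast_sub h2N.le] at this
      exact_mod_cast this
    rw [h2] at h1
    push_cast at h1
    omega
  refine ⟨h2N, hR.closing_le_one (by omega), hR.closing_le_one le_rfl, fun c hc hcN => ?_, hlast⟩
  rcases eq_or_lt_of_le hcN with rfl | hcN
  · exact hlast.ge
  · have := (mem_heightArcs.1 (hR.subset_heightArcs hm hR.root_mem)).2.2.2.1 c (by omega) hcN
    omega

/-- A balanced arc system is determined by the numbers of arcs ending at each point. -/
theorem IsBalanced.eq_heightArcs {m N : ℕ} (hm : 1 ≤ m) {R : Finset (ℕ × ℕ)}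
    (hR : IsBalanced m N R) : R = heightArcs m N (height m (closing R)) := by
  refine Finset.eq_of_subset_of_card_le (hR.subset_heightArcs hm) ?_
  have h1 := (hR.isDyckHeight hm).isBalanced hm
  exact (Nat.eq_of_mul_eq_mul_left hm (h1.mul_card.trans hR.mul_card.symm)).le

/-! ### Regions of an arc system -/

/-- The analogue of `IsRegion` for an arc system on the points `1, …, N`. -/
def IsLineRegion (N : ℕ) (R : Finset (ℕ × ℕ)) (S : Finset ℕ) : Prop :=
  3 ≤ S.card ∧ (∀ a ∈ S, 1 ≤ a ∧ a ≤ N) ∧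
    ∀ a ∈ S, ∀ b ∈ S, a < b →
      (CyclicallyConsecutive S a b → b = a + 1 ∨ (a, b) ∈ R) ∧
      (¬ CyclicallyConsecutive S a b → (a, b) ∉ R)

theorem card_insert_interior (R : Finset (ℕ × ℕ)) {d : ℕ × ℕ} (hd : d.1 < d.2) :
    (insert d.1 (insert d.2 (interior R d))).card = (interior R d).card + 2 := by
  rw [Finset.card_insert_of_notMem, Finset.card_insert_of_notMem]
  · simp [mem_interior]
  · simp [mem_interior, hd.ne]

/-- Two points `a`, `b` of the region below `d` between which there is no point of the region are
neighbours or joined by an arc: the outermost arc above `a + 1` that is strictly inside `d`. -/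
theorem IsArcSystem.mem_of_gap {N : ℕ} {R : Finset (ℕ × ℕ)} (hR : IsArcSystem N R)
    {d : ℕ × ℕ} (hd : d ∈ R) {a b : ℕ} (hab : a + 1 < b) (hda : d.1 ≤ a) (hbd : b ≤ d.2)
    (ha : d.1 < a → a ∈ interior R d) (hb : b < d.2 → b ∈ interior R d)
    (hgap : ∀ c, a < c → c < b → c ∉ interior R d) : (a, b) ∈ R := by
  have h1 := hgap (a + 1) (by omega) hab
  rw [mem_interior] at h1
  push Not at h1
  obtain ⟨f, hf, hf1, hf2, hf3⟩ := h1 ⟨by omega, by omega⟩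
  obtain ⟨e, he, hmax⟩ := Finset.exists_max_image
    (R.filter fun e => e.1 ≤ a ∧ a + 1 < e.2 ∧ (e.1 ≤ d.1 → e.2 < d.2))
    (fun e => e.2 - e.1) ⟨f, Finset.mem_filter.2 ⟨hf, by omega, hf2, hf3⟩⟩
  simp only [Finset.mem_filter] at he hmax
  obtain ⟨heR, he1, he2, he3⟩ := he
  have hcr : ∀ e ∈ R, ∀ f ∈ R, (e.1 < f.1 → f.1 < e.2 → f.2 ≤ e.2) := by
    intro e he f hf h1 h2
    have := hR.noncrossing e he f hf
    unfold Crosses at this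
    omega
  have hin : d.1 ≤ e.1 ∧ e.2 ≤ d.2 := by
    have h1 := hcr e heR d hd
    have h2 := hcr d hd e heR
    omega
  have hea : e.1 = a := by
    by_contra hne
    have h2 := (mem_interior.1 (ha (by omega))).2 e heR (by omega) (by omega)
    omega
  have heb : e.2 ≤ b := by
    by_contra! hlt
    have h2 := (mem_interior.1 (hb (by omega))).2 e heR (by omega) (by omega)
    omega
  have hbe : e.2 = b := by
    by_contra hne
    have h2 := hgap e.2 (by omega) (by omega)
    rw [mem_interior] at h2
    push Not at h2
    obtain ⟨g, hg, hg1, hg2, hg3⟩ := h2 ⟨by omega, by omega⟩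
    have h4 := hcr e heR g hg
    have h5 := hmax g ⟨hg, by omega, by omega, hg3⟩
    have h6 := hR.lt e heR
    omega
  rw [← hea, ← hbe]
  exact heR

/-- The end points of an arc and the points for which it is the innermost arc span a region. -/
theorem IsArcSystem.isLineRegion {N : ℕ} {R : Finset (ℕ × ℕ)} (hR : IsArcSystem N R)
    {d : ℕ × ℕ} (hd : d ∈ R) :
    IsLineRegion N R (insert d.1 (insert d.2 (interior R d))) := by
  have h1 := hR.one_le d hd
  have h2 := hR.lt d hd
  have h3 := hR.le d hd
  set S := insert d.1 (insert d.2 (interior R d)) with hS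
  have hmem : ∀ c, c ∈ S ↔ c = d.1 ∨ c = d.2 ∨ c ∈ interior R d := by simp [S]
  have hbd : ∀ c ∈ S, d.1 ≤ c ∧ c ≤ d.2 := by
    intro c hc
    rcases (hmem c).1 hc with rfl | rfl | hc
    · omega
    · omega
    · have := (mem_interior.1 hc).1
      omega
  refine ⟨?_, ?_, ?_⟩
  · have : (interior R d).Nonempty := by
      -- let `e` be the longest arc strictly inside `d` that starts at `d.1`, or `d` if there is none
      obtain ⟨e, he, hmax⟩ := Finset.exists_max_image
        (R.filter fun e => e.1 = d.1 ∧ e.2 < d.2 ∨ e = d)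
        (fun e => if e = d then 0 else e.2) ⟨d, by simp [hd]⟩
      simp only [Finset.mem_filter] at he hmax
      -- the first point after `d.1` in the region: the end of that arc, or else `d.1 + 1`
      have key : ∃ x ∈ Finset.Ioo d.1 d.2, (∀ f ∈ R, f.1 = d.1 → f.2 < d.2 → f.2 ≤ x) ∧
          (x = d.1 + 1 ∨ (d.1, x) ∈ R) := by
        obtain ⟨heR, ⟨he1, he2⟩ | rfl⟩ := he
        · have hne : e ≠ d := by rintro rfl; omega
          have h4 := hR.lt e heR
          refine ⟨e.2, Finset.mem_Ioo.2 (by omega), fun f hf hf1 hf2 => ?_, Or.inr ?_⟩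
          · have h5 := hmax f ⟨hf, Or.inl ⟨hf1, hf2⟩⟩
            have hne' : f ≠ d := by rintro rfl; omega
            simpa [hne, hne'] using h5
          · rw [← he1]
            exact heR
        · refine ⟨e.1 + 1, Finset.mem_Ioo.2 (by omega), fun f hf hf1 hf2 => ?_, Or.inl rfl⟩
          have h5 := hmax f ⟨hf, Or.inl ⟨hf1, hf2⟩⟩
          have hne' : f ≠ e := by rintro rfl; omega
          have := hR.lt f hf
          simp [hne'] at h5
          omega
      obtain ⟨x, hx, hx1, hx2⟩ := key
      rw [Finset.mem_Ioo] at hx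
      refine ⟨x, mem_interior.2 ⟨hx, fun f hf hf1 hf2 => ?_⟩⟩
      have h4 := hR.noncrossing f hf d hd
      have h5 : ¬ (d.1 < f.1) := by
        intro h6
        rcases hx2 with rfl | hx2
        · omega
        · exact hR.noncrossing _ hx2 f hf (Or.inl ⟨h6, hf1, hf2⟩)
      have h6 := hx1 f hf
      unfold Crosses at h4
      omega
    rw [hS, card_insert_interior R (by omega)]
    have := this.card_pos
    omega
  · intro a ha
    have := hbd a ha
    omega
  · intro a ha b hb hab
    have ha' := hbd a ha
    have hb' := hbd b hb
    constructor
    · rintro (hcc | hcc)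
      · by_cases hb1 : b = a + 1
        · exact Or.inl hb1
        · refine Or.inr (hR.mem_of_gap hd (by omega) ha'.1 hb'.2 (fun h => ?_) (fun h => ?_)
            fun c hc hc' hci => hcc c ((hmem c).2 (by simp [hci])) ⟨hc, hc'⟩)
          · rcases (hmem a).1 ha with rfl | rfl | hc
            · omega
            · omega
            · exact hc
          · rcases (hmem b).1 hb with rfl | rfl | hc
            · omega
            · omega
            · exact hc
      · have h5 := hcc d.1 ((hmem _).2 (by simp))
        have h6 := hcc d.2 ((hmem _).2 (by simp))
        right
        rw [show a = d.1 by omega, show b = d.2 by omega]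
        exact hd
    · intro hcc habR
      unfold CyclicallyConsecutive at hcc
      push Not at hcc
      obtain ⟨⟨c, hcS, hac, hcb⟩, c', hc'S, hc'⟩ := hcc
      have h7 := hbd c' hc'S
      rcases (hmem c).1 hcS with rfl | rfl | hci
      · omega
      · omega
      · have := (mem_interior.1 hci).2 _ habR hac hcb
        simp only at this
        omega

/-- Every region is the region below an arc, namely the one that joins its extreme points. -/
theorem IsArcSystem.exists_of_isLineRegion {N : ℕ} {R : Finset (ℕ × ℕ)} (hR : IsArcSystem N R)
    {S : Finset ℕ} (hS : IsLineRegion N R S) :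
    ∃ d ∈ R, S = insert d.1 (insert d.2 (interior R d)) := by
  obtain ⟨hcard, hSN, hS⟩ := hS
  have hne : S.Nonempty := Finset.card_pos.1 (by omega)
  set a := S.min' hne with ha
  set b := S.max' hne with hb
  have haS : a ∈ S := S.min'_mem hne
  have hbS : b ∈ S := S.max'_mem hne
  have hbd : ∀ c ∈ S, a ≤ c ∧ c ≤ b := fun c hc => ⟨S.min'_le c hc, S.le_max' c hc⟩
  have hab : a + 1 < b := by
    have h1 : S ⊆ Finset.Icc a b := fun c hc => Finset.mem_Icc.2 (hbd c hc)
    have h2 := Finset.card_le_card h1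
    rw [Nat.card_Icc] at h2
    omega
  have hd : (a, b) ∈ R := by
    rcases (hS a haS b hbS (by omega)).1 (Or.inr hbd) with h | h
    · omega
    · exact h
  -- a point outside of `S` between `a` and `b` is below an arc that joins neighbours in `S`
  have hgap : ∀ c, a < c → c < b → c ∉ S → ∃ e ∈ R, e.1 ∈ S ∧ e.2 ∈ S ∧ e.1 < c ∧ c < e.2 ∧
      (a < e.1 ∨ e.2 < b) := by
    intro c hac hcb hcS
    have hL : (S.filter (· < c)).Nonempty := ⟨a, by simp [haS, hac]⟩
    have hU : (S.filter (c < ·)).Nonempty := ⟨b, by simp [hbS, hcb]⟩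
    have hp := Finset.max'_mem _ hL
    have hq := Finset.min'_mem _ hU
    have hpmax := fun x hx => Finset.le_max' (S.filter (· < c)) x hx
    have hqmin := fun x hx => Finset.min'_le (S.filter (c < ·)) x hx
    set p := (S.filter (· < c)).max' hL
    set q := (S.filter (c < ·)).min' hU
    simp only [Finset.mem_filter] at hp hq hpmax hqmin
    have hno : ∀ x ∈ S, ¬ (p < x ∧ x < q) := by
      rintro x hx ⟨h1, h2⟩
      rcases lt_trichotomy x c with h3 | rfl | h3
      · have := hpmax x ⟨hx, h3⟩
        omega
      · exact hcS hx
      · have := hqmin x ⟨hx, h3⟩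
        omega
    rcases (hS p hp.1 q hq.1 (by omega)).1 (Or.inl hno) with h | h
    · omega
    · refine ⟨(p, q), h, hp.1, hq.1, hp.2, hq.2, ?_⟩
      by_contra! hcon
      have h3 := hbd p hp.1
      have h4 := hbd q hq.1
      simp only at hcon
      have h5 : S ⊆ {a, b} := by
        intro x hx
        have := hno x hx
        have := hbd x hx
        simp only [Finset.mem_insert, Finset.mem_singleton]
        omega
      have h6 := Finset.card_le_card h5
      rw [Finset.card_pair (by omega)] at h6
      omega
  refine ⟨(a, b), hd, ?_⟩
  ext c
  simp only [Finset.mem_insert]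
  constructor
  · intro hc
    have hc' := hbd c hc
    by_cases h1 : c = a
    · exact Or.inl h1
    by_cases h2 : c = b
    · exact Or.inr (Or.inl h2)
    refine Or.inr (Or.inr (mem_interior.2 ⟨⟨by simp only; omega, by simp only; omega⟩, ?_⟩))
    intro e he hec hce
    have hnc := hR.noncrossing e he _ hd
    by_contra hcon
    unfold Crosses at hnc
    simp only at hnc hcon
    have he1 : e.1 ∈ S := by
      by_contra h3
      obtain ⟨f, hf, hf1, hf2, hf3, hf4, hf5⟩ := hgap e.1 (by
        by_contra h4
        exact h3 ((show e.1 = a by omega) ▸ haS)) (by omega) h3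
      by_cases h5 : c < f.2
      · have := (hS f.1 hf1 f.2 hf2 (by omega)).2 ?_
        · exact this hf
        · rintro (h6 | h6)
          · exact h6 c hc ⟨by omega, h5⟩
          · have := h6 a haS
            have := h6 b hbS
            omega
      · exact hR.noncrossing f hf e he (Or.inl ⟨hf3, hf4, by omega⟩)
    have he2 : e.2 ∈ S := by
      by_contra h3
      obtain ⟨f, hf, hf1, hf2, hf3, hf4, hf5⟩ := hgap e.2 (by omega) (by
        by_contra h4
        exact h3 ((show e.2 = b by omega) ▸ hbS)) h3
      by_cases h5 : f.1 < c
      · have := (hS f.1 hf1 f.2 hf2 (by omega)).2 ?_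
        · exact this hf
        · rintro (h6 | h6)
          · exact h6 c hc ⟨h5, by omega⟩
          · have := h6 a haS
            have := h6 b hbS
            omega
      · exact hR.noncrossing e he f hf (Or.inl ⟨by omega, hf3, hf4⟩)
    refine (hS e.1 he1 e.2 he2 (by omega)).2 ?_ he
    rintro (h6 | h6)
    · exact h6 c hc ⟨hec, hce⟩
    · have := h6 a haS
      have := h6 b hbS
      omega
  · rintro (rfl | rfl | hc)
    · exact haS
    · exact hbS
    · by_contra hcS
      obtain ⟨⟨h1, h2⟩, h3⟩ := mem_interior.1 hc
      obtain ⟨e, he, he1, he2, he3, he4, he5⟩ := hgap c h1 h2 hcS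
      have := h3 e he he3 he4
      simp only at this
      omega

theorem IsArcSystem.isBalanced_iff {m N : ℕ} {R : Finset (ℕ × ℕ)} (hR : IsArcSystem N R) :
    IsBalanced m N R ↔ ∀ S, IsLineRegion N R S → S.card = m + 2 := by
  constructor
  · intro h S hS
    obtain ⟨d, hd, rfl⟩ := hR.exists_of_isLineRegion hS
    have := hR.lt d hd
    rw [card_insert_interior R (by omega), h.card_interior d hd]
  · intro h
    refine ⟨hR, fun d hd => ?_⟩
    have h1 := h _ (hR.isLineRegion hd)
    have := hR.lt d hd
    rw [card_insert_interior R (by omega)] at h1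
    omega

/-! ### Moving the apex of the polygon to the end -/

/-- The segment `d` of the polygon with vertices `0, …, N - 1` after the apex `0` has been
renumbered as `N`. -/
def rotate (N : ℕ) (d : ℕ × ℕ) : ℕ × ℕ := if d.1 = 0 then (d.2, N) else d

/-- The arc system on `1, …, N` given by the diagonals in `Q`, the apex `0` being renumbered as
`N`; the outer arc `(1, N)` is the side of the polygon that joins `0` and `1`. -/
def arcs (N : ℕ) (Q : Finset (ℕ × ℕ)) : Finset (ℕ × ℕ) := insert (1, N) (Q.image (rotate N))

section Rotate

variable {N : ℕ} {Q : Finset (ℕ × ℕ)}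

theorem mem_arcs_of_lt {a b : ℕ} (ha : 1 ≤ a) (hb : b < N) :
    (a, b) ∈ arcs N Q ↔ (a, b) ∈ Q := by
  simp only [arcs, Finset.mem_insert, Finset.mem_image, rotate, Prod.mk.injEq]
  constructor
  · rintro (h | ⟨d, hd, h⟩)
    · omega
    · split_ifs at h with h0
      · simp only [Prod.mk.injEq] at h
        omega
      · exact h ▸ hd
  · intro h
    exact Or.inr ⟨_, h, if_neg (by simp only; omega)⟩

theorem mem_arcs_last (hQ : ∀ d ∈ Q, IsDiagonal N d) {a : ℕ} :
    (a, N) ∈ arcs N Q ↔ a = 1 ∨ (0, a) ∈ Q := by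
  simp only [arcs, Finset.mem_insert, Finset.mem_image, rotate, Prod.mk.injEq]
  constructor
  · rintro (h | ⟨d, hd, h⟩)
    · exact Or.inl h.1
    · split_ifs at h with h0
      · simp only [Prod.mk.injEq] at h
        rw [← h.1, ← h0]
        exact Or.inr hd
      · have := (hQ d hd).2.1
        rw [h] at this
        exact absurd this (lt_irrefl _)
  · rintro (h | h)
    · exact Or.inl ⟨h, trivial⟩
    · exact Or.inr ⟨_, h, by simp⟩

theorem mem_arcs (hQ : ∀ d ∈ Q, IsDiagonal N d) {d : ℕ × ℕ} : d ∈ arcs N Q ↔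
    (1 ≤ d.1 ∧ d.2 < N ∧ d ∈ Q) ∨ (d.2 = N ∧ (d.1 = 1 ∨ (0, d.1) ∈ Q)) := by
  obtain ⟨a, b⟩ := d
  constructor
  · intro h
    by_cases hb : b = N
    · subst hb
      exact Or.inr ⟨rfl, (mem_arcs_last hQ).1 h⟩
    · left
      simp only [arcs, Finset.mem_insert, Finset.mem_image, rotate, Prod.mk.injEq] at h
      obtain h | ⟨d, hd, h⟩ := h
      · omega
      · split_ifs at h with h0
        · simp only [Prod.mk.injEq] at h
          omega
        · have := (hQ d hd).2.1
          subst h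
          exact ⟨by omega, this, hd⟩
  · rintro (⟨h1, h2, h3⟩ | ⟨h1, h2⟩)
    · exact (mem_arcs_of_lt h1 h2).2 h3
    · simp only at h1 h2
      rw [h1]
      exact (mem_arcs_last hQ).2 h2

theorem isArcSystem_arcs (h2N : 2 < N) (hQ : ∀ d ∈ Q, IsDiagonal N d)
    (hcr : ∀ d ∈ Q, ∀ e ∈ Q, ¬ Crosses d e) : IsArcSystem N (arcs N Q) := by
  have hD := fun d hd => hQ d hd
  simp only [IsDiagonal, IsSide] at hD
  refine ⟨Finset.mem_insert_self _ _, ?_, ?_, ?_, ?_⟩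
  · intro d hd
    rcases (mem_arcs hQ).1 hd with h | ⟨-, h | h⟩
    · exact h.1
    · exact h.ge
    · have := hD _ h
      simp only at this
      omega
  · intro d hd
    rcases (mem_arcs hQ).1 hd with h | ⟨h', h | h⟩
    · have := hD _ h.2.2
      omega
    · omega
    · have := hD _ h
      simp only [true_and] at this
      omega
  · intro d hd
    rcases (mem_arcs hQ).1 hd with h | h
    · exact h.2.1.le
    · exact h.1.le
  · intro d hd e he
    rcases (mem_arcs hQ).1 hd with h | ⟨h', h⟩ <;> rcases (mem_arcs hQ).1 he with k | ⟨k', k⟩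
    · exact hcr d h.2.2 e k.2.2
    · rcases k with k | k
      · unfold Crosses
        omega
      · have := hcr d h.2.2 _ k
        unfold Crosses at this ⊢
        simp only at this
        omega
    · rcases h with h | h
      · unfold Crosses
        omega
      · have := hcr e k.2.2 _ h
        unfold Crosses at this ⊢
        simp only at this
        omega
    · unfold Crosses
      omega

theorem not_crosses_of_isArcSystem_arcs (hQ : ∀ d ∈ Q, IsDiagonal N d)
    (hR : IsArcSystem N (arcs N Q)) : ∀ d ∈ Q, ∀ e ∈ Q, ¬ Crosses d e := by
  have hmem : ∀ d ∈ Q, rotate N d ∈ arcs N Q := fun d hd =>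
    Finset.mem_insert_of_mem (Finset.mem_image_of_mem _ hd)
  intro d hd e he hcr
  have h1 := hR.noncrossing _ (hmem d hd) _ (hmem e he)
  have h2 := (hQ d hd).2.1
  have h3 := (hQ e he).2.1
  unfold Crosses rotate at h1
  unfold Crosses at hcr
  split_ifs at h1 <;> omega

/-- Renumbering the apex does not change regions. -/
theorem isRegion_iff_isLineRegion (hQ : ∀ d ∈ Q, IsDiagonal N d) {S S' : Finset ℕ}
    (hS : ∀ a ∈ S, a < N) (hS' : ∀ a ∈ S', 1 ≤ a ∧ a ≤ N) (hcard : S.card = S'.card)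
    (hmem : ∀ a, 1 ≤ a → a < N → (a ∈ S ↔ a ∈ S')) (hlast : 0 ∈ S ↔ N ∈ S') :
    IsRegion N Q S ↔ IsLineRegion N (arcs N Q) S' := by
  have hcc : ∀ a b, 1 ≤ a → a < b → b < N →
      (CyclicallyConsecutive S a b ↔ CyclicallyConsecutive S' a b) := by
    intro a b ha hab hb
    refine or_congr ⟨fun h c hc hc' => ?_, fun h c hc hc' => ?_⟩
      ⟨fun h c hc => ?_, fun h c hc => ?_⟩
    · exact h c ((hmem c (by omega) (by omega)).2 hc) hc'
    · exact h c ((hmem c (by omega) (by omega)).1 hc) hc'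
    · have h1 := hS' c hc
      by_cases hcN : c = N
      · have := h 0 (hlast.2 (hcN ▸ hc))
        omega
      · exact h c ((hmem c (by omega) (by omega)).2 hc)
    · have h1 := hS c hc
      by_cases hc0 : c = 0
      · have := h N (hlast.1 (hc0 ▸ hc))
        omega
      · exact h c ((hmem c (by omega) (by omega)).1 hc)
  have hcc0 : ∀ b, 1 ≤ b → b < N →
      (CyclicallyConsecutive S 0 b ↔ CyclicallyConsecutive S' b N) := by
    intro b hb hbN
    rw [CyclicallyConsecutive, CyclicallyConsecutive, or_comm]
    refine or_congr ⟨fun h c hc hc' => ?_, fun h c hc => ?_⟩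
      ⟨fun h c hc => ?_, fun h c hc hc' => ?_⟩
    · have := h c ((hmem c (by omega) (by omega)).2 hc)
      omega
    · have h1 := hS c hc
      by_cases hc0 : c = 0
      · omega
      · have := h c ((hmem c (by omega) (by omega)).1 hc)
        omega
    · have h1 := hS' c hc
      by_cases hcN : c = N
      · omega
      · have := h c ((hmem c (by omega) (by omega)).2 hc)
        omega
    · have := h c ((hmem c (by omega) (by omega)).1 hc)
      omega
  unfold IsRegion IsLineRegion
  rw [hcard]
  refine and_congr_right fun _ => ?_
  rw [and_iff_right hS, and_iff_right hS']
  constructor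
  · intro h a ha b hb hab
    have ha' := hS' a ha
    have hb' := hS' b hb
    by_cases hbN : b = N
    · subst hbN
      have h1 := h 0 (hlast.2 hb) a ((hmem a ha'.1 hab).2 ha) ha'.1
      rw [hcc0 a ha'.1 hab] at h1
      rw [mem_arcs_last hQ]
      refine ⟨fun hc => ?_, fun hc hor => ?_⟩
      · rcases h1.1 hc with ⟨-, -, h2⟩ | h2
        · simp only at h2
          omega
        · exact Or.inr (Or.inr h2)
      · rcases hor with rfl | h2
        · exact hc (Or.inr hS')
        · exact h1.2 hc h2
    · have hbN : b < N := by omega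
      have h1 := h a ((hmem a ha'.1 (by omega)).2 ha) b ((hmem b hb'.1 hbN).2 hb) hab
      rw [hcc a b ha'.1 hab hbN] at h1
      rw [mem_arcs_of_lt ha'.1 hbN]
      refine ⟨fun hc => (h1.1 hc).imp_left ?_, h1.2⟩
      rintro ⟨-, -, h2⟩
      simp only at h2
      omega
  · intro h a ha b hb hab
    have ha' := hS a ha
    have hb' := hS b hb
    by_cases ha0 : a = 0
    · subst ha0
      have h1 := h b ((hmem b hab hb').1 hb) N (hlast.1 ha) hb'
      rw [← hcc0 b hab hb', mem_arcs_last hQ] at h1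
      refine ⟨fun hc => ?_, fun hc hor => h1.2 hc (Or.inr hor)⟩
      rcases h1.1 hc with h2 | rfl | h2
      · exact Or.inl ⟨hab, hb', Or.inr ⟨rfl, h2.symm⟩⟩
      · exact Or.inl ⟨hab, hb', Or.inl rfl⟩
      · exact Or.inr h2
    · have ha1 : 1 ≤ a := by omega
      have h1 := h a ((hmem a ha1 ha').1 ha) b ((hmem b (by omega) hb').1 hb) hab
      rw [← hcc a b ha1 hab hb', mem_arcs_of_lt ha1 hb'] at h1
      exact ⟨fun hc => (h1.1 hc).imp_left fun h2 => ⟨hab, hb', Or.inl h2⟩, h1.2⟩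

theorem isAngulation_iff {m n : ℕ} (hm : 1 ≤ m) (hn : 1 ≤ n) {Q : Finset (ℕ × ℕ)} :
    IsAngulation m n Q ↔ (∀ d ∈ Q, IsDiagonal (m * n + 2) d) ∧
      IsBalanced m (m * n + 2) (arcs (m * n + 2) Q) := by
  have h2N : 2 < m * n + 2 := by
    have := Nat.mul_pos hm hn
    omega
  set N := m * n + 2
  rw [IsAngulation]
  refine and_congr_right fun hQ => ?_
  constructor
  · rintro ⟨hcr, hreg⟩
    have hR := isArcSystem_arcs h2N hQ hcr
    refine hR.isBalanced_iff.2 fun S' hS' => ?_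
    have hinj : Set.InjOn (fun a => if a = N then 0 else a) (S' : Set ℕ) := by
      intro a ha b hb hab
      have := hS'.2.1 a ha
      have := hS'.2.1 b hb
      simp only at hab
      split_ifs at hab <;> omega
    rw [← Finset.card_image_of_injOn hinj]
    refine hreg _ ((isRegion_iff_isLineRegion hQ ?_ hS'.2.1 (Finset.card_image_of_injOn hinj)
      ?_ ?_).2 hS')
    · intro a ha
      obtain ⟨b, hb, rfl⟩ := Finset.mem_image.1 ha
      have := hS'.2.1 b hb
      split_ifs <;> omega
    · intro a ha haN
      rw [Finset.mem_image]
      constructor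
      · rintro ⟨b, hb, h⟩
        split_ifs at h
        · omega
        · exact h ▸ hb
      · intro h
        exact ⟨a, h, if_neg (by omega)⟩
    · rw [Finset.mem_image]
      constructor
      · rintro ⟨b, hb, h⟩
        have := hS'.2.1 b hb
        split_ifs at h with h1
        · rwa [h1] at hb
        · omega
      · intro h
        exact ⟨N, h, if_pos rfl⟩
  · intro hR
    refine ⟨not_crosses_of_isArcSystem_arcs hQ hR.toIsArcSystem, fun S hS => ?_⟩
    have hinj : Set.InjOn (fun a => if a = 0 then N else a) (S : Set ℕ) := by
      intro a ha b hb hab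
      have := hS.2.1 a ha
      have := hS.2.1 b hb
      simp only at hab
      split_ifs at hab <;> omega
    rw [← Finset.card_image_of_injOn hinj]
    refine hR.toIsArcSystem.isBalanced_iff.1 hR _ ((isRegion_iff_isLineRegion hQ hS.2.1 ?_
      (Finset.card_image_of_injOn hinj).symm ?_ ?_).1 hS)
    · intro a ha
      obtain ⟨b, hb, rfl⟩ := Finset.mem_image.1 ha
      have := hS.2.1 b hb
      split_ifs <;> omega
    · intro a ha haN
      rw [Finset.mem_image]
      constructor
      · intro h
        exact ⟨a, h, if_neg (by omega)⟩
      · rintro ⟨b, hb, h⟩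
        split_ifs at h
        · omega
        · exact h ▸ hb
    · rw [Finset.mem_image]
      constructor
      · intro h
        exact ⟨0, h, if_pos rfl⟩
      · rintro ⟨b, hb, h⟩
        have := hS.2.1 b hb
        split_ifs at h with h1
        · exact h1 ▸ hb
        · omega

theorem arcs_injOn : Set.InjOn (arcs N) {Q | ∀ d ∈ Q, IsDiagonal N d} := by
  have key : ∀ Q Q' : Finset (ℕ × ℕ), (∀ d ∈ Q, IsDiagonal N d) → (∀ d ∈ Q', IsDiagonal N d) →
      arcs N Q = arcs N Q' → Q ⊆ Q' := by
    rintro Q Q' hQ hQ' heq ⟨a, b⟩ hd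
    have h1 := hQ _ hd
    simp only [IsDiagonal, IsSide] at h1
    by_cases ha : a = 0
    · subst ha
      have h2 := (mem_arcs_last hQ).2 (Or.inr hd)
      rw [heq, mem_arcs_last hQ'] at h2
      exact h2.resolve_left (by omega)
    · rwa [← mem_arcs_of_lt (N := N) (by omega) h1.2.1, ← heq,
        mem_arcs_of_lt (by omega) h1.2.1]
  exact fun Q hQ Q' hQ' heq => (key Q Q' hQ hQ' heq).antisymm (key Q' Q hQ' hQ heq.symm)

theorem IsArcSystem.exists_eq_arcs {R : Finset (ℕ × ℕ)} (hR : IsArcSystem N R) :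
    ∃ Q : Finset (ℕ × ℕ), (∀ d ∈ Q, IsDiagonal N d) ∧ arcs N Q = R := by
  have hroot := hR.lt _ hR.root_mem
  simp only at hroot
  refine ⟨(R.erase (1, N)).image fun d => if d.2 = N then (0, d.1) else d, ?_, ?_⟩
  · intro d hd
    obtain ⟨e, he, rfl⟩ := Finset.mem_image.1 hd
    rw [Finset.mem_erase] at he
    have h1 := hR.one_le e he.2
    have h2 := hR.lt e he.2
    have h3 := hR.le e he.2
    simp only [IsDiagonal, IsSide]
    split_ifs with h
    · have : e.1 ≠ 1 := fun h4 => he.1 (Prod.ext h4 h)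
      simp only
      omega
    · omega
  · rw [arcs, Finset.image_image, Finset.image_congr (g := id), Finset.image_id,
      Finset.insert_erase hR.root_mem]
    intro d hd
    have h1 := hR.one_le d (Finset.mem_of_mem_erase hd)
    simp only [Function.comp, rotate, id]
    split_ifs with h h' h'
    · exact Prod.ext rfl h.symm
    · exact absurd rfl h'
    · omega
    · rfl

end Rotate

/-! ### Leading monomials -/

theorem degree_X_sub_X {m n : ℕ} {i j : Var m n} (hij : i < j) :
    (X i - X j : PolyRing m n) ≠ 0 ∧
      (MonomialOrder.lex (σ := Var m n)).degree (X i - X j : PolyRing m n) =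
        Finsupp.single i 1 := by
  have h : (MonomialOrder.lex (σ := Var m n)).degree (X i - X j : PolyRing m n) =
      Finsupp.single i 1 := by
    rw [MonomialOrder.degree_sub_of_lt, MonomialOrder.degree_X]
    rw [MonomialOrder.degree_X, MonomialOrder.degree_X, MonomialOrder.lex_lt_iff]
    exact Finsupp.Lex.single_strictAnti hij
  exact ⟨(MonomialOrder.lex (σ := Var m n)).ne_zero_of_degree_ne_zero (by rw [h]; simp), h⟩

theorem crossedLabels_eq {m n q r s : ℕ} (hs : s < m) (hqr : q + r < n) :
    crossedLabels m n (m * q + s + 1, m * q + s + 2 + m * r) = Finset.Icc (q + 1) (q + r) := by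
  ext k
  rw [crossedLabels, Finset.mem_filter, Finset.mem_Ico, Finset.mem_Icc, Crosses, fanDiagonal]
  simp only
  have h1 : m * q + s < m * k ↔ q < k := by
    constructor
    · intro h
      by_contra! hk
      have := Nat.mul_le_mul_left m hk
      omega
    · intro h
      have := Nat.mul_le_mul_left m (Nat.succ_le_of_lt h)
      rw [Nat.mul_succ] at this
      omega
  have h2 : m * k ≤ m * q + s + m * r ↔ k ≤ q + r := by
    constructor
    · intro h
      by_contra! hk
      have := Nat.mul_le_mul_left m (Nat.succ_le_of_lt hk)
      rw [Nat.mul_succ, Nat.mul_add] at this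
      omega
    · intro h
      have := Nat.mul_le_mul_left m h
      rw [Nat.mul_add] at this
      omega
  omega

/-- For a diagonal with `m * r` vertices between its end points, neither of which is the apex, the
polynomial `m_d` is the difference of the variable at the position given by the larger end point
and a variable in an earlier block. -/
theorem exists_diagonalPoly_eq {m n q r s : ℕ} (hs : s < m) (hr : 1 ≤ r) (hqr : q + r < n) :
    ∃ t : Fin m, diagonalPoly m n (m * q + s + 1, m * q + s + 2 + m * r) =
      X (varIndex ⟨q + r, hqr⟩ ⟨s, hs⟩) - X (varIndex ⟨q, by omega⟩ t) := by
  have hm : 0 < m := by omega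
  refine ⟨⟨letter m (m * q + s + 1), Nat.mod_lt _ hm⟩, ?_⟩
  have hfan : (m * q + s + 1, m * q + s + 2 + m * r) ∉ fan m n := by
    simp [fan, fanDiagonal]
  have hlet : letter m (m * q + s + 2 + m * r) = s := by
    rw [letter, show m * q + s + 2 + m * r + m - 2 = s + m * (q + r + 1) by
      rw [Nat.mul_add, Nat.mul_add]; omega, Nat.add_mul_mod_self_left, Nat.mod_eq_of_lt hs]
  rw [diagonalPoly, if_neg hfan, crossedLabels_eq hs hqr, Finset.coe_Icc,
    csSup_Icc (by omega), csInf_Icc (by omega)]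
  simp only [hlet]
  rw [letterVar, letterVar, dif_pos ⟨⟨by omega, by omega⟩, hs⟩,
    dif_pos ⟨⟨by omega, by omega⟩, Nat.mod_lt _ hm⟩]
  simp

theorem varIndex_lt {m n : ℕ} {k l : Fin n} (hkl : k < l) (a b : Fin m) :
    varIndex l a < varIndex k b := by
  rw [varIndex, varIndex, OrderDual.toDual_lt_toDual, Prod.Lex.toLex_lt_toLex]
  exact Or.inl hkl

theorem varIndex_inj {m n : ℕ} {k l : Fin n} {a b : Fin m} :
    varIndex k a = varIndex l b ↔ k = l ∧ a = b := by
  simp [varIndex]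

theorem mul_add_eq_iff {m k l a b : ℕ} (ha : a < m) (hb : b < m) :
    m * k + a = m * l + b ↔ k = l ∧ a = b := by
  constructor
  · intro h
    have h1 := congrArg (· / m) h
    have hm : 0 < m := by omega
    simp only [Nat.mul_add_div hm, Nat.div_eq_of_lt ha, Nat.div_eq_of_lt hb] at h1
    have h2 : k = l := by omega
    subst h2
    exact ⟨rfl, by omega⟩
  · rintro ⟨rfl, rfl⟩
    rfl

theorem IsBalanced.exists_eq_add {m N : ℕ} {R : Finset (ℕ × ℕ)} (hR : IsBalanced m N R) {a b : ℕ}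
    (hd : (a, b) ∈ R) : ∃ r, 1 ≤ r ∧ b = a + 1 + m * r := by
  have h1 := hR.mul_card_inside hd
  have h2 := hR.lt _ hd
  simp only at h1 h2
  refine ⟨_, ?_, (by omega : b = a + 1 + m * (R.filter fun e => a ≤ e.1 ∧ e.2 ≤ b).card)⟩
  exact Finset.card_pos.2 ⟨(a, b), by simp [hd]⟩

/-- The leading monomial of `m_d` is `1` if `d` contains the apex, and otherwise the variable at
the position given by the larger end point of `d`. -/
theorem degree_diagonalPoly {m n : ℕ} (hm : 1 ≤ m) {Q : Finset (ℕ × ℕ)}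
    (hQ : ∀ d ∈ Q, IsDiagonal (m * n + 2) d) (hR : IsBalanced m (m * n + 2) (arcs (m * n + 2) Q))
    {d : ℕ × ℕ} (hd : d ∈ Q) :
    diagonalPoly m n d ≠ 0 ∧ ∀ (k : Fin n) (a : Fin m),
      (MonomialOrder.lex (σ := Var m n)).degree (diagonalPoly m n d) (varIndex k a) =
        if d.1 ≠ 0 ∧ d.2 = m * k + a + 2 then 1 else 0 := by
  obtain ⟨x, y⟩ := d
  have hD := hQ _ hd
  simp only [IsDiagonal, IsSide] at hD
  by_cases hx : x = 0
  · subst hx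
    obtain ⟨r, hr, hy⟩ := hR.exists_eq_add ((mem_arcs_last hQ).2 (Or.inr hd))
    have hrn : r < n := by
      by_contra! h
      have := Nat.mul_le_mul_left m h
      omega
    have hfan : (0, y) ∈ fan m n := by
      refine Finset.mem_image.2 ⟨n - r, Finset.mem_Ico.2 (by omega), ?_⟩
      have := Nat.mul_sub m n r
      have := Nat.mul_le_mul_left m hrn.le
      rw [fanDiagonal, Prod.mk.injEq]
      omega
    rw [diagonalPoly, if_pos hfan]
    simp
  · obtain ⟨r, hr, hy⟩ := hR.exists_eq_add ((mem_arcs_of_lt (by omega) hD.2.1).2 hd)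
    obtain ⟨q, s, hs, rfl⟩ : ∃ q s, s < m ∧ x = m * q + s + 1 :=
      ⟨(x - 1) / m, (x - 1) % m, Nat.mod_lt _ hm, by
        rw [Nat.div_add_mod]
        omega⟩
    have hqr : q + r < n := by
      by_contra! h
      have := Nat.mul_le_mul_left m h
      rw [Nat.mul_add] at this
      omega
    obtain rfl : y = m * q + s + 2 + m * r := by omega
    obtain ⟨t, ht⟩ := exists_diagonalPoly_eq hs hr hqr
    have hlt : varIndex (m := m) ⟨q + r, hqr⟩ ⟨s, hs⟩ < varIndex ⟨q, by omega⟩ t :=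
      varIndex_lt (by rw [Fin.lt_def]; simp only; omega) _ _
    rw [ht]
    refine ⟨(degree_X_sub_X hlt).1, fun k a => ?_⟩
    rw [(degree_X_sub_X hlt).2, Finsupp.single_apply]
    refine if_congr ?_ rfl rfl
    have h1 := mul_add_eq_iff (k := q + r) (l := k) hs a.isLt
    rw [varIndex_inj, Fin.ext_iff, Fin.ext_iff, ← h1, Nat.mul_add]
    simp only
    omega

theorem closing_arcs {N : ℕ} {Q : Finset (ℕ × ℕ)} (hQ : ∀ d ∈ Q, IsDiagonal N d) {b : ℕ}
    (hb : b < N) : closing (arcs N Q) b = (Q.filter fun d => d.1 ≠ 0 ∧ d.2 = b).card := by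
  rw [closing]
  congr 1
  ext d
  rw [Finset.mem_filter, Finset.mem_filter, mem_arcs hQ]
  constructor
  · rintro ⟨⟨h1, h2, h3⟩ | ⟨h1, h2⟩, h4⟩
    · exact ⟨h3, by omega, h4⟩
    · omega
  · rintro ⟨h1, h2, h3⟩
    exact ⟨Or.inl ⟨by omega, by omega, h1⟩, h3⟩

theorem angulationPoly_ne_zero {m n : ℕ} (hm : 1 ≤ m) {Q : Finset (ℕ × ℕ)}
    (hQ : ∀ d ∈ Q, IsDiagonal (m * n + 2) d)
    (hR : IsBalanced m (m * n + 2) (arcs (m * n + 2) Q)) : angulationPoly m n Q ≠ 0 :=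
  Finset.prod_ne_zero_iff.2 fun _ hd => (degree_diagonalPoly hm hQ hR hd).1

theorem degree_angulationPoly {m n : ℕ} (hm : 1 ≤ m) {Q : Finset (ℕ × ℕ)}
    (hQ : ∀ d ∈ Q, IsDiagonal (m * n + 2) d) (hR : IsBalanced m (m * n + 2) (arcs (m * n + 2) Q))
    (k : Fin n) (a : Fin m) :
    (MonomialOrder.lex (σ := Var m n)).degree (angulationPoly m n Q) (varIndex k a) =
      closing (arcs (m * n + 2) Q) (blockIndex k a + 2) := by
  rw [closing_arcs hQ (by have := (blockIndex k a).isLt; omega), angulationPoly,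
    MonomialOrder.degree_prod fun d hd => (degree_diagonalPoly hm hQ hR hd).1,
    Finsupp.finsetSum_apply, Finset.card_filter]
  exact Finset.sum_congr rfl fun d hd => (degree_diagonalPoly hm hQ hR hd).2 k a

theorem vectorMonomial_eq {m n : ℕ} (v : Fin (m * n) → ℕ) (f : Var m n →₀ ℕ)
    (hf : ∀ k a, f (varIndex k a) = v (blockIndex k a)) :
    vectorMonomial v = monomial f 1 := by
  rw [monomial_eq, Finsupp.prod_fintype _ _ (by simp), C_1, one_mul, vectorMonomial,
    ← Fintype.prod_prod_type'
      (f := fun k a => (X (varIndex k a) : PolyRing m n) ^ v (blockIndex k a))]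
  exact Fintype.prod_equiv (toLex.trans OrderDual.toDual) _ _ fun p => by
    rw [← hf]
    rfl

theorem blockIndex_surjective {m n : ℕ} (l : Fin (m * n)) :
    ∃ (k : Fin n) (a : Fin m), blockIndex k a = l := by
  have hm : 0 < m := Nat.pos_of_mul_pos_right (by have := l.isLt; omega : 0 < m * n)
  refine ⟨⟨l / m, Nat.div_lt_of_lt_mul l.isLt⟩, ⟨l % m, Nat.mod_lt _ hm⟩, Fin.ext ?_⟩
  exact Nat.div_add_mod _ _

theorem leadingMonomial_eq_vectorMonomial_iff {m n : ℕ} (hm : 1 ≤ m) {Q : Finset (ℕ × ℕ)}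
    (hQ : ∀ d ∈ Q, IsDiagonal (m * n + 2) d) (hR : IsBalanced m (m * n + 2) (arcs (m * n + 2) Q))
    (v : Fin (m * n) → ℕ) :
    leadingMonomial (angulationPoly m n Q) = vectorMonomial v ↔
      ∀ l : Fin (m * n), closing (arcs (m * n + 2) Q) (l + 2) = v l := by
  constructor
  · intro h l
    obtain ⟨k, a, rfl⟩ := blockIndex_surjective l
    rw [vectorMonomial_eq v (Finsupp.equivFunOnFinite.symm fun i =>
      v (blockIndex (ofLex (OrderDual.ofDual i)).1 (ofLex (OrderDual.ofDual i)).2))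
      (fun _ _ => rfl), leadingMonomial] at h
    rw [← degree_angulationPoly hm hQ hR, monomial_left_injective one_ne_zero h]
    rfl
  · intro h
    exact (vectorMonomial_eq v _ fun k a => by rw [degree_angulationPoly hm hQ hR, h]).symm

/-! ### Dyck vectors -/

/-- Along a run of right steps the condition is the strongest at the end of the run. -/
theorem forall_prefix_append_replicate {m c : ℕ} (L : List (ℕ × ℕ)) :
    (∀ l, l <+: L ++ List.replicate c (m, 0) → l.sum.1 ≤ l.sum.2) ↔
      (∀ l, l <+: L → l.sum.1 ≤ l.sum.2) ∧ L.sum.1 + m * c ≤ L.sum.2 := by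
  induction c with
  | zero =>
    simp only [List.replicate_zero, List.append_nil, mul_zero, add_zero]
    exact ⟨fun h => ⟨h, h L List.prefix_rfl⟩, fun h => h.1⟩
  | succ c ih =>
    simp only [List.replicate_succ', ← List.append_assoc, List.prefix_concat_iff, or_imp,
      forall_and, forall_eq, ih]
    simp only [List.sum_append, List.sum_replicate, List.sum_singleton, Prod.fst_add,
      Prod.snd_add, Prod.smul_fst, Prod.smul_snd, smul_eq_mul, mul_zero, add_zero]
    rw [Nat.mul_succ, Nat.mul_comm c m]
    constructor
    · rintro ⟨h1, h2, h3⟩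
      exact ⟨h2, by omega⟩
    · rintro ⟨h1, h2⟩
      exact ⟨by omega, h1, by omega⟩

theorem forall_prefix_flatMap (m : ℕ) (w : ℕ → ℕ) (K : ℕ) :
    (((List.range K).map w).flatMap fun c => List.replicate c (m, 0) ++ [(0, 1)]).sum =
        (m * ∑ i ∈ Finset.range K, w i, K) ∧
      ((∀ l, l <+: ((List.range K).map w).flatMap
          (fun c => List.replicate c (m, 0) ++ [(0, 1)]) → l.sum.1 ≤ l.sum.2) ↔
        ∀ l < K, m * ∑ i ∈ Finset.range (l + 1), w i ≤ l) := by
  induction K with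
  | zero => simp [Prod.zero_eq_mk]
  | succ K ih =>
    obtain ⟨ih1, ih2⟩ := ih
    have hL : ((List.range (K + 1)).map w).flatMap
        (fun c => List.replicate c (m, 0) ++ [(0, 1)]) =
        ((List.range K).map w).flatMap (fun c => List.replicate c (m, 0) ++ [(0, 1)]) ++
          List.replicate (w K) (m, 0) ++ [(0, 1)] := by
      simp [List.range_succ]
    rw [hL]
    set L := ((List.range K).map w).flatMap (fun c => List.replicate c (m, 0) ++ [(0, 1)])
    have hsum : (L ++ List.replicate (w K) (m, 0) ++ [(0, 1)]).sum =
        (m * ∑ i ∈ Finset.range (K + 1), w i, K + 1) := by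
      rw [List.sum_append, List.sum_append, ih1, Finset.sum_range_succ]
      simp only [List.sum_replicate, List.sum_singleton]
      refine Prod.ext ?_ ?_
      · simp only [Prod.fst_add, Prod.smul_fst, smul_eq_mul]
        ring
      · simp
    refine ⟨hsum, ?_⟩
    simp only [List.prefix_concat_iff, or_imp, forall_and, forall_eq,
      forall_prefix_append_replicate, ih2, hsum, ih1]
    simp only [Order.lt_add_one_iff, Finset.sum_range_succ, Nat.mul_add]
    constructor
    · rintro ⟨h1, h2, h3⟩ l hl
      rcases eq_or_lt_of_le hl with rfl | hl
      · exact h3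
      · exact h2 l hl
    · intro h
      have := h K le_rfl
      exact ⟨by omega, fun l hl => h l hl.le, this⟩

/-- The Dyck condition in terms of the height, for the vector shifted by two. -/
theorem isDyckVector_iff {m n : ℕ} {v : Fin (m * n) → ℕ} {u : ℕ → ℕ} (h0 : u 0 = 0)
    (h1 : u 1 = 0) (hu : ∀ l : Fin (m * n), u (l + 2) = v l) :
    IsDyckVector v ↔ ∀ c, 2 ≤ c → c < m * n + 2 → 2 ≤ height m u c := by
  have hv : List.ofFn v = (List.range (m * n)).map fun i => u (i + 2) := by
    refine List.ext_getElem (by simp) fun i hi hi' => ?_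
    rw [List.length_ofFn] at hi
    simpa using (hu ⟨i, hi⟩).symm
  rw [IsDyckVector, latticePath, hv, (forall_prefix_flatMap m _ _).2]
  have key : ∀ l : ℕ, height m u (l + 2) =
      l + 2 - m * ∑ i ∈ Finset.range (l + 1), (u (i + 2) : ℤ) := by
    intro l
    rw [height, Finset.sum_range_succ', Finset.sum_range_succ']
    simp [h0, h1]
  constructor
  · intro h c hc hcN
    obtain ⟨l, rfl⟩ : ∃ l, c = l + 2 := ⟨c - 2, by omega⟩
    have := h l (by omega)
    zify at this
    rw [key]
    omega
  · intro h l hl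
    have := h (l + 2) (by omega) (by omega)
    rw [key] at this
    zify
    omega

theorem exists_isDyckHeight {m n : ℕ} (hm : 1 ≤ m) (hn : 1 ≤ n) {v : Fin (m * n) → ℕ}
    (hv : IsDyckVector v) :
    ∃ u : ℕ → ℕ, IsDyckHeight m (m * n + 2) u ∧ ∀ l : Fin (m * n), u (l + 2) = v l := by
  have hpos := Nat.mul_pos hm hn
  obtain ⟨w, hw⟩ : ∃ w : ℕ → ℕ, ∀ l : Fin (m * n), w l = v l :=
    ⟨fun i => if h : i < m * n then v ⟨i, h⟩ else 0, fun l => by simp⟩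
  -- the entry at `m * n + 2` counts the diagonals through the apex, and one more for the side
  -- that joins the vertices `0` and `1`
  let u : ℕ → ℕ := fun c => if c < 2 then 0 else if c < m * n + 2 then w (c - 2) else
    n - ∑ i ∈ Finset.range (m * n + 2), if i < 2 then 0 else w (i - 2)
  have h0 : u 0 = 0 := by simp [u]
  have h1 : u 1 = 0 := by simp [u]
  have hu : ∀ l : Fin (m * n), u ((l : ℕ) + 2) = v l := by
    intro l
    simp [u, hw]
  have hD := (isDyckVector_iff h0 h1 hu).1 hv
  have hlast : height m u (m * n + 2) = 2 := by
    have hsum : ∑ i ∈ Finset.range (m * n + 2), (if i < 2 then 0 else w (i - 2)) =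
        ∑ i ∈ Finset.range (m * n + 2), u i := by
      refine Finset.sum_congr rfl fun i hi => ?_
      rw [Finset.mem_range] at hi
      simp [u, hi]
    have h2 : u (m * n + 2) = n - ∑ i ∈ Finset.range (m * n + 2), u i := by
      rw [← hsum]
      simp [u]
    have h3 := hD (m * n + 1) (by omega) (by omega)
    rw [height, ← Nat.cast_sum, show m * n + 1 + 1 = m * n + 2 from rfl] at h3
    have h4 : ∑ i ∈ Finset.range (m * n + 2), u i ≤ n := by
      have : m * ∑ i ∈ Finset.range (m * n + 2), u i ≤ m * n := by
        zify
        push_cast at h3 ⊢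
        linarith
      exact Nat.le_of_mul_le_mul_left this hm
    rw [height, ← Nat.cast_sum, Finset.sum_range_succ, h2, Nat.add_sub_cancel' h4]
    push_cast
    ring
  refine ⟨u, ⟨by omega, h0, h1, fun c hc hcN => ?_, hlast⟩, hu⟩
  rcases eq_or_lt_of_le hcN with rfl | hcN
  · exact hlast.ge
  · exact hD c hc hcN

/-! ### The bijection -/

/-- The number of arcs ending at `N` need not be known: it is determined by the others. -/
theorem IsBalanced.eq_of_closing_eq {m N : ℕ} (hm : 1 ≤ m) {R R' : Finset (ℕ × ℕ)}
    (hR : IsBalanced m N R) (hR' : IsBalanced m N R')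
    (h : ∀ b, 2 ≤ b → b < N → closing R b = closing R' b) : R = R' := by
  have hD := hR.isDyckHeight hm
  have hD' := hR'.isDyckHeight hm
  have h2N := hD.two_lt
  have hlt : ∀ b, b < N → closing R b = closing R' b := by
    intro b hb
    by_cases hb1 : b ≤ 1
    · rw [hR.closing_le_one hb1, hR'.closing_le_one hb1]
    · exact h b (by omega) hb
  -- both heights are `2` at `N`, so they agree there too
  have hheight : ∀ c, c ≤ N → height m (closing R) c = height m (closing R') c := by
    intro c hc
    rcases eq_or_lt_of_le hc with rfl | hc
    · rw [hD.last, hD'.last]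
    · rw [height, height, Finset.sum_congr rfl fun i hi => by
        rw [hlt i (by rw [Finset.mem_range] at hi; omega)]]
  rw [hR.eq_heightArcs hm, hR'.eq_heightArcs hm]
  ext ⟨a, b⟩
  rw [mem_heightArcs, mem_heightArcs]
  refine and_congr_right fun ha => and_congr_right fun hab => and_congr_right fun hb => ?_
  rw [hheight a (by omega), hheight b hb, hheight (b - 1) (by omega)]
  refine and_congr_left fun _ => forall_congr' fun c => forall_congr' fun _ =>
    forall_congr' fun _ => ?_
  rw [hheight c (by omega)]

end FanBasis

theorem mainTheorem1 (m n : ℕ) (hm : 1 ≤ m) (hn : 1 ≤ n) :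
    (∀ Q : Finset (ℕ × ℕ), FanBasis.IsAngulation m n Q → FanBasis.angulationPoly m n Q ≠ 0) ∧
    Set.BijOn (fun Q => FanBasis.leadingMonomial (FanBasis.angulationPoly m n Q))
      {Q : Finset (ℕ × ℕ) | FanBasis.IsAngulation m n Q} (FanBasis.monomialBasis m n) := by
  open FanBasis in
  refine ⟨fun Q hQ => ?_, fun Q hQ => ?_, fun Q hQ Q' hQ' heq => ?_, ?_⟩
  · obtain ⟨hQ1, hQ2⟩ := (isAngulation_iff hm hn).1 hQ
    exact angulationPoly_ne_zero hm hQ1 hQ2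
  · obtain ⟨hQ1, hQ2⟩ := (isAngulation_iff hm hn).1 hQ
    have hD := hQ2.isDyckHeight hm
    refine ⟨fun l => closing (arcs (m * n + 2) Q) (l + 2),
      (isDyckVector_iff hD.zero hD.one fun l => rfl).2 fun c hc hcN => hD.two_le c hc hcN.le,
      ((leadingMonomial_eq_vectorMonomial_iff hm hQ1 hQ2 _).2 fun l => rfl).symm⟩
  · obtain ⟨hQ1, hQ2⟩ := (isAngulation_iff hm hn).1 hQ
    obtain ⟨hQ'1, hQ'2⟩ := (isAngulation_iff hm hn).1 hQ'
    refine arcs_injOn hQ1 hQ'1 (hQ2.eq_of_closing_eq hm hQ'2 fun b hb hbN => ?_)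
    have h1 := (leadingMonomial_eq_vectorMonomial_iff hm hQ'1 hQ'2 _).2 fun l => rfl
    have h2 := (leadingMonomial_eq_vectorMonomial_iff hm hQ1 hQ2 _).1 (heq.trans h1)
      ⟨b - 2, by omega⟩
    simpa [show b - 2 + 2 = b by omega] using h2
  · rintro _ ⟨v, hv, rfl⟩
    obtain ⟨u, hu, huv⟩ := exists_isDyckHeight hm hn hv
    have hR := hu.isBalanced hm
    obtain ⟨Q, hQ, hQR⟩ := hR.toIsArcSystem.exists_eq_arcs
    rw [← hQR] at hR
    refine ⟨Q, (isAngulation_iff hm hn).2 ⟨hQ, hR⟩,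
      (leadingMonomial_eq_vectorMonomial_iff hm hQ hR v).2 fun l => ?_⟩
    rw [hQR, hu.closing_heightArcs hm (by have := l.isLt; omega), huv]
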